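/- Let $d\ge1$ and let $p(x,y)$, $x,y\in\mathbb Z^d$, be a Markov transition function that is symmetric, translation invariant ($p(x,y)=p(0,y-x)$), of finite range and irreducible. Let $(X_t)$ be the continuous-time random walk that jumps at rate $1$ according to $p$, and let $\{\eta(t):t\ge0\}$ be the system of independent random walkers on $\mathbb N^{\mathbb Z^d}$: every particle performs, independently of the others, such a random walk. Let $\rho:\mathbb R^d\to[0,\infty)$ be a density profile of at most polynomial growth and, for $N\in\mathbb N$, let the process start from the local-equilibrium measure $\nu_\rho=\bigotimes_{x\in\mathbb Z^d}\mathrm{Poisson}(\rho(x/N))$; denote the corresponding expectation by $\mathbb E_{\nu_\rho}$. Put $\rho_t(x)=\mathbb E_x[\rho(X_t/N)]$ and, for a function $r:\mathbb Z^d\to[0,\infty)$ and a finite configuration $\xi$, $$\mathscr D_r(\xi,\eta)=\prod_{x}\sum_{j=0}^{\xi_x}\binom{\xi_x}{j}(-r(x))^{\xi_x-j}\,\eta_x(\eta_x-1)\cdots(\eta_x-j+1)$$ (products of monic Charlier polynomials). Let $k\ge1$, $\mathbf x=(x_1,\dots,x_k)\in(\mathbb Z^d)^k$, let $\phi$ be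 a Schwartz function on $\mathbb R^d$, and define the $k$-th order fluctuation field $$X_N(\mathbf x,\rho,\phi,t)=\sum_{z\in\mathbb Z^d}\phi\left(\tfrac zN\right)\mathscr D_{\rho_{N^2t}}\Big(\sum_{i=1}^k\delta_{z+x_i},\,\eta(N^2t)\Big).$$ Then for every $T>0$ there is a constant $C(T)$ (not depending on $N$, but possibly on $d,p,\rho,\phi,\mathbf x$ and $T$) such that, for all $N$ big enough, the series defining $X_N(\mathbf x,\rho,\phi,t)$ converges absolutely almost surely and defines a square integrable random variable for every $t\ge0$, the function $(s,t)\mapsto\mathbb E_{\nu_\rho}[X_N(\mathbf x,\rho,\phi,t)X_N(\mathbf x,\rho,\phi,s)]$ is integrable on $[0,T]^2$, and $$\frac1{N^d}\int_0^T\!\!\int_0^T\mathbb E_{\nu_\rho}\big[X_N(\mathbf x,\rho,\phi,t)\,X_N(\mathbf x,\rho,\phi,s)\big]\,ds\,dt\;\le\; C(T)\,N^{-\frac{2(k-1)d}{2+(k-1)d}} .$$ -/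

import Mathlib

open MeasureTheory ProbabilityTheory Filter
open scoped NNReal ENNReal SchwartzMap

noncomputable section

namespace BoltzmannGibbs

/-- The lattice `ℤ^d`. -/
abbrev Site (d : ℕ) : Type := Fin d → ℤ

/-- Particle configurations: `η x` is the number of particles at `x`. -/
abbrev Config (d : ℕ) : Type := Site d → ℕ

/-- Assumptions on the single-particle jump probabilities `p x y` (for each `x`, `p x` is a
probability distribution on `ℤ^d`): symmetric, translation invariant, of finite range and
irreducible. -/
structure IsAdmissible {d : ℕ} (p : Site d → PMF (Site d)) : Prop where
  symm : ∀ x y, p x y = p y x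
  translation : ∀ x y, p x y = p 0 (y - x)
  finite_range : ∃ R : ℝ, 0 < R ∧ ∀ x y : Site d, R < ‖x - y‖ → p x y = 0
  irreducible : ∀ x y, Relation.ReflTransGen (fun a b => 0 < p a b) x y

/-- Law of the position, after `n` jumps, of the discrete-time random walk started from `x`. -/
def stepLaw {d : ℕ} (p : Site d → PMF (Site d)) : ℕ → Site d → PMF (Site d)
  | 0, x => PMF.pure x
  | n + 1, x => (p x).bind (stepLaw p n)

/-- Law at time `t` of the continuous-time random walk started from `x` which jumps at rate `1`
according to `p`: the number of jumps up to time `t` is Poisson with parameter `t`. -/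
def walkLaw {d : ℕ} (p : Site d → PMF (Site d)) (t : ℝ≥0) (x : Site d) : Measure (Site d) :=
  (poissonMeasure t).bind fun n => (stepLaw p n x).toMeasure

instance {d : ℕ} (p : Site d → PMF (Site d)) (t : ℝ≥0) (x : Site d) :
    IsProbabilityMeasure (walkLaw p t x) := by
  constructor
  rw [walkLaw, Measure.bind_apply MeasurableSet.univ (measurable_of_countable _).aemeasurable]
  simp

/-- The configuration of the particles labelled by `(x, i)` with `i < η x`, when the particle
with label `(x, i)` sits at `w (x, i)`. -/
def countAt {d : ℕ} (η : Config d) (w : Site d × ℕ → Site d) : Config d :=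
  fun y => Set.ncard {a : Site d × ℕ | a.2 < η a.1 ∧ w a = y}

/-- Transition function of the system of independent random walkers: the particles of `η`
perform independent continuous-time random walks during a time `t`. -/
def irwTransition {d : ℕ} (p : Site d → PMF (Site d)) (t : ℝ≥0) (η : Config d) :
    Measure (Config d) :=
  (Measure.infinitePi fun a : Site d × ℕ => walkLaw p t a.1).map (countAt η)

/-- The family of random configurations `η t`, `t ≥ 0`, is the system of independent random
walkers with initial distribution `μ`: it is a Markov process (with respect to its own
filtration) with transition function `irwTransition p` and initial law `μ`. -/
structure IsIRW {d : ℕ} (p : Site d → PMF (Site d)) (μ : Measure (Config d))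
    {Ω : Type*} [MeasurableSpace Ω] (P : Measure Ω) (η : ℝ≥0 → Ω → Config d) : Prop where
  measurable : ∀ t, Measurable (η t)
  initial : P.map (η 0) = μ
  markov : ∀ s t : ℝ≥0, s ≤ t → ∀ A : Set (Config d), MeasurableSet A →
    P[(η t ⁻¹' A).indicator (fun _ => (1 : ℝ)) |
        ⨆ u : Set.Iic s, MeasurableSpace.comap (η u) inferInstance]
      =ᵐ[P] fun ω => (irwTransition p (t - s) (η s ω)).real A

/-- Monic Charlier polynomial of degree `k` in `n`, orthogonal with respect to the Poisson
distribution with parameter `r`. -/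
def charlier (r : ℝ) (k n : ℕ) : ℝ :=
  ∑ j ∈ Finset.range (k + 1), (k.choose j : ℝ) * (-r) ^ (k - j) * (n.descFactorial j : ℝ)

/-- Orthogonal polynomial indexed by the finite configuration `ξ`, for the inhomogeneous Poisson
product measure with density `r`. -/
def orthoPoly {d : ℕ} (r : Site d → ℝ) (ξ : Site d →₀ ℕ) (η : Config d) : ℝ :=
  ξ.prod fun x k => charlier (r x) k (η x)

/-- The finite configuration associated with the coordinate vector `x = (x_1, …, x_k)`. -/
def toConfig {d k : ℕ} (x : Fin k → Site d) : Site d →₀ ℕ :=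
  ∑ i, Finsupp.single (x i) 1

/-- The macroscopic point `x / N` of `ℝ^d`. -/
def macro_point {d : ℕ} (N : ℕ) (x : Site d) : EuclideanSpace ℝ (Fin d) :=
  WithLp.toLp 2 fun i => (x i : ℝ) / (N : ℝ)

/-- The local-equilibrium measure: product over `x` of Poisson laws with parameter `ρ (x / N)`. -/
def localEquilibrium {d : ℕ} (ρ : EuclideanSpace ℝ (Fin d) → ℝ≥0) (N : ℕ) :
    Measure (Config d) :=
  Measure.infinitePi fun x => poissonMeasure (ρ (macro_point N x))

/-- The density `E_x[ρ(X_t / N)]` at the microscopic time `t` and the site `x`. -/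
def density {d : ℕ} (p : Site d → PMF (Site d)) (ρ : EuclideanSpace ℝ (Fin d) → ℝ≥0) (N : ℕ)
    (t : ℝ≥0) (x : Site d) : ℝ :=
  ∫ y, (ρ (macro_point N y) : ℝ) ∂(walkLaw p t x)

/-- The summand at `z` of the field of the polynomial attached to `x`, at the macroscopic
time `t`. The configuration `ζ` is that of the system at the microscopic time `N ^ 2 * t`. -/
def fieldTerm {d k : ℕ} (p : Site d → PMF (Site d)) (ρ : EuclideanSpace ℝ (Fin d) → ℝ≥0)
    (φ : 𝓢(EuclideanSpace ℝ (Fin d), ℝ)) (x : Fin k → Site d) (N : ℕ) (t : ℝ≥0)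
    (ζ : Config d) (z : Site d) : ℝ :=
  φ (macro_point N z) *
    orthoPoly (density p ρ N ((N : ℝ≥0) ^ 2 * t)) (toConfig fun i => z + x i) ζ

/-- The `k`-th order fluctuation field at the macroscopic time `t`. -/
def field {d k : ℕ} (p : Site d → PMF (Site d)) (ρ : EuclideanSpace ℝ (Fin d) → ℝ≥0)
    (φ : 𝓢(EuclideanSpace ℝ (Fin d), ℝ)) (x : Fin k → Site d) (N : ℕ)
    {Ω : Type*} (η : ℝ≥0 → Ω → Config d) (t : ℝ≥0) (ω : Ω) : ℝ :=
  ∑' z : Site d, fieldTerm p ρ φ x N t (η ((N : ℝ≥0) ^ 2 * t) ω) z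

end BoltzmannGibbs

end

noncomputable section

namespace BoltzmannGibbs

open scoped Nat
open Finset.HasAntidiagonal (antidiagonal)

/-! ### The heat kernel bound -/

/-! Two-time covariances of the orthogonal polynomials are explicit. Falling factorials of the
occupation numbers count injective tuples of particles, and distinct particles move independently.
Hence pairing a function of the earlier configuration with a later falling factorial gives a sum,
over starting tuples of the same length, of walk probabilities times the pairing at the earlier time
(`HasPoissonMoments.lintegral_mul_fallingProd`). At the earlier time the polynomial of `ξ` is
orthogonal to every falling factorial of degree at most that of `ξ`, except its own, and the later
polynomial equals its falling factorial up to lower degree. So the covariance is the squared norm of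
the earlier polynomial times the weight of transitions of `k` independent walkers
(`HasPoissonMoments.integral_orthoPoly_mul_orthoPoly`). Only factorial moments enter: the property
`HasPoissonMoments` is carried along the flow, and it is never shown that the law at a later time is
a product of Poisson laws.

Now fix the earlier site and sum over the later translate `z`. One walker's probabilities sum to
one, and each of the other `k - 1` is at most `C τ ^ (-d/2)` at microscopic time `τ`. The remaining
lattice sum has order `N ^ d`, because the decay of `φ` beats the polynomial growth of the density.
With `n = (k - 1) d`, the covariance at macroscopic time distance `u`, divided by `N ^ d`, is thus
bounded by a constant times both `1` and `(N ^ 2 u) ^ (-n/2)`. In the double time integral the strip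
`|t - s| < ε` contributes order `ε` and its complement order `(N ^ 2 ε) ^ (-n/2)`; the two agree for
`ε = N ^ (-2n/(2+n))`, which is the claimed rate.

The heat kernel bound is proved without Fourier analysis. The law of the walk is `e ^ (-t)` times an
exponential in the group algebra of the lattice, which factors over the jumps. Along `d` linearly
independent jumps a site has at most one representation, so its coefficient is at most a product of
`d` single Poisson weights, each of order `t ^ (-1/2)` after normalization; the other jumps only
average this bound. -/

theorem tsum_sum_antidiagonal (f : ℕ × ℕ → ℝ≥0∞) :
    ∑' n, ∑ q ∈ antidiagonal n, f q = ∑' i, ∑' j, f (i, j) := by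
  rw [← ENNReal.tsum_prod (f := fun i j => f (i, j)),
    ← (Finset.HasAntidiagonal.sigmaAntidiagonalEquivProd (A := ℕ)).tsum_eq, ENNReal.tsum_sigma']
  refine tsum_congr fun n => ?_
  rw [tsum_fintype, ← Finset.sum_coe_sort]
  rfl

theorem inv_factorial_mul_choose (i j : ℕ) :
    (((i + j) ! : ℕ) : ℝ≥0∞)⁻¹ * ((i + j).choose i : ℝ≥0∞)
      = ((i ! : ℕ) : ℝ≥0∞)⁻¹ * ((j ! : ℕ) : ℝ≥0∞)⁻¹ := by
  have h : ∀ n : ℕ, ((n ! : ℕ) : ℝ≥0∞) ≠ 0 := fun n => by exact_mod_cast n.factorial_ne_zero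
  have h' : ∀ n : ℕ, ((n ! : ℕ) : ℝ≥0∞) ≠ ⊤ := fun n => ENNReal.natCast_ne_top _
  rw [← ENNReal.mul_inv (Or.inl (h i)) (Or.inl (h' i)), mul_comm, ← div_eq_mul_inv,
    ENNReal.div_eq_inv_mul, ← Nat.add_choose_mul_factorial_mul_factorial i j,
    ← Nat.choose_symm_add]
  push_cast
  have hc : ((i + j).choose i : ℝ≥0∞) ≠ 0 := by
    exact_mod_cast (Nat.choose_pos (Nat.le_add_right i j)).ne'
  rw [mul_assoc, ENNReal.mul_inv (Or.inl hc) (Or.inl (ENNReal.natCast_ne_top _)), mul_comm,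
    ← mul_assoc, ENNReal.mul_inv_cancel hc (ENNReal.natCast_ne_top _), one_mul]

/-! ### Exponentials in a commutative group algebra -/

variable {G : Type*} [AddCommGroup G]

/-- Coefficients of the exponential of an element of the group algebra. -/
def expKernel (g : AddMonoidAlgebra ℝ≥0∞ G) (y : G) : ℝ≥0∞ :=
  ∑' n : ℕ, ((n ! : ℕ) : ℝ≥0∞)⁻¹ * (g ^ n).coeff y

theorem coeff_single_mul_sub (v : G) (c : ℝ≥0∞) (g : AddMonoidAlgebra ℝ≥0∞ G) (y : G) :
    (AddMonoidAlgebra.single v c * g).coeff y = c * g.coeff (y - v) :=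
  g.coeff_single_mul_eq_mul_coeff (y - v) fun m _ => by
    rw [eq_sub_iff_add_eq, add_comm]

/-- This is `exp (a + b) = exp a * exp b` for commuting elements (binomial theorem and Cauchy
product); the exponential of a monomial puts mass `c ^ i / i!` at `i • v`. -/
theorem expKernel_single_add (v : G) (c : ℝ≥0∞) (g : AddMonoidAlgebra ℝ≥0∞ G) (y : G) :
    expKernel (AddMonoidAlgebra.single v c + g) y
      = ∑' i : ℕ, ((i ! : ℕ) : ℝ≥0∞)⁻¹ * c ^ i * expKernel g (y - i • v) := by
  have h : ∀ n : ℕ, ((n ! : ℕ) : ℝ≥0∞)⁻¹ * ((AddMonoidAlgebra.single v c + g) ^ n).coeff y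
      = ∑ q ∈ antidiagonal n, ((q.1 ! : ℕ) : ℝ≥0∞)⁻¹ * c ^ q.1 *
          (((q.2 ! : ℕ) : ℝ≥0∞)⁻¹ * (g ^ q.2).coeff (y - q.1 • v)) := by
    intro n
    rw [(Commute.all _ g).add_pow', AddMonoidAlgebra.coeff_sum, Finsupp.finsetSum_apply,
      Finset.mul_sum]
    refine Finset.sum_congr rfl fun q hq => ?_
    obtain rfl := Finset.HasAntidiagonal.mem_antidiagonal.mp hq
    rw [AddMonoidAlgebra.single_pow, AddMonoidAlgebra.coeff_smul_apply, coeff_single_mul_sub,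
      nsmul_eq_mul, ← mul_assoc, inv_factorial_mul_choose]
    ring
  rw [expKernel, tsum_congr h, tsum_sum_antidiagonal (fun q => ((q.1 ! : ℕ) : ℝ≥0∞)⁻¹ * c ^ q.1 *
          (((q.2 ! : ℕ) : ℝ≥0∞)⁻¹ * (g ^ q.2).coeff (y - q.1 • v)))]
  simp_rw [ENNReal.tsum_mul_left, expKernel]

theorem expKernel_zero (y : G) [Decidable (y = 0)] :
    expKernel (0 : AddMonoidAlgebra ℝ≥0∞ G) y = if y = 0 then 1 else 0 := by
  rw [expKernel, tsum_eq_single 0]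
  · classical
    simp [AddMonoidAlgebra.one_def, AddMonoidAlgebra.coeff_single, Finsupp.single_apply, eq_comm]
  · intro n hn
    simp [zero_pow hn]

theorem inv_factorial_mul_pow (c : ℝ≥0) (i : ℕ) :
    ((i ! : ℕ) : ℝ≥0∞)⁻¹ * (c : ℝ≥0∞) ^ i = ENNReal.ofReal ((c : ℝ) ^ i / (i ! : ℕ)) := by
  rw [ENNReal.ofReal_div_of_pos (by positivity), ENNReal.ofReal_pow c.coe_nonneg,
    ENNReal.ofReal_natCast, ENNReal.ofReal_coe_nnreal, ENNReal.div_eq_inv_mul]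

theorem tsum_inv_factorial_mul_pow (c : ℝ≥0) :
    ∑' i : ℕ, ((i ! : ℕ) : ℝ≥0∞)⁻¹ * (c : ℝ≥0∞) ^ i = ENNReal.ofReal (Real.exp c) := by
  simp_rw [inv_factorial_mul_pow]
  rw [← ENNReal.ofReal_tsum_of_nonneg (fun i => by positivity)
    (Real.summable_pow_div_factorial _), Real.exp_eq_exp_ℝ, NormedSpace.exp_eq_tsum_div]

/-- The element of the group algebra with coefficients `c` on the finite set `s`. -/
def weightSum (s : Finset G) (c : G → ℝ≥0) : AddMonoidAlgebra ℝ≥0∞ G :=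
  ∑ v ∈ s, AddMonoidAlgebra.single v (c v : ℝ≥0∞)

theorem weightSum_insert [DecidableEq G] {s : Finset G} {v : G} (hv : v ∉ s) (c : G → ℝ≥0) :
    weightSum (insert v s) c = AddMonoidAlgebra.single v (c v : ℝ≥0∞) + weightSum s c :=
  Finset.sum_insert hv

/-- Every power of the weight sum is supported on sums of elements of `s`, so nothing leaves their
rational span. -/
theorem expKernel_weightSum_eq_zero [DecidableEq G] {V : Type*} [AddCommGroup V] [Module ℚ V]
    (ι : G →+ V) (c : G → ℝ≥0) (s : Finset G) (y : G)
    (hy : ι y ∉ Submodule.span ℚ (ι '' (s : Set G))) : expKernel (weightSum s c) y = 0 := by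
  induction s using Finset.induction_on generalizing y with
  | empty =>
    have : y ≠ 0 := by
      rintro rfl
      simp at hy
    rw [weightSum, Finset.sum_empty, expKernel_zero, if_neg this]
  | insert v s hv ih =>
    rw [weightSum_insert hv, expKernel_single_add, ENNReal.tsum_eq_zero]
    intro i
    rw [ih, mul_zero]
    intro h
    apply hy
    have h1 : ι y = ι (y - i • v) + (i : ℕ) • ι v := by simp
    rw [h1]
    refine add_mem (Submodule.span_mono (Set.image_mono (by simp)) h) ?_
    exact nsmul_mem (Submodule.subset_span (Set.mem_image_of_mem _ (by simp))) i

/-- If `v` is outside the span of the other generators, then `y - i • v` lies in that span for at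
most one `i`, so the series over `i` has at most one nonzero term and costs a single weight instead
of the total mass. -/
theorem expKernel_weightSum_le_prod [DecidableEq G] {V : Type*} [AddCommGroup V] [Module ℚ V]
    (ι : G →+ V) (c : G → ℝ≥0) (M : G → ℝ≥0∞)
    (hM : ∀ v, ∀ i : ℕ, ((i ! : ℕ) : ℝ≥0∞)⁻¹ * (c v : ℝ≥0∞) ^ i ≤ M v) (s : Finset G)
    (hs : LinearIndepOn ℚ ι (s : Set G)) (y : G) :
    expKernel (weightSum s c) y ≤ ∏ v ∈ s, M v := by
  induction s using Finset.induction_on generalizing y with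
  | empty =>
    rw [weightSum, Finset.sum_empty, expKernel_zero, Finset.prod_empty]
    split_ifs <;> simp
  | insert v s hv ih =>
    rw [weightSum_insert hv, expKernel_single_add, Finset.prod_insert hv]
    rw [Finset.coe_insert, linearIndepOn_insert (by simpa using hv)] at hs
    by_cases h : ∃ i : ℕ, ι (y - i • v) ∈ Submodule.span ℚ (ι '' (s : Set G))
    · obtain ⟨i, hi⟩ := h
      rw [tsum_eq_single i]
      · exact mul_le_mul' (hM v i) (ih hs.1 _)
      · intro j hj
        rw [expKernel_weightSum_eq_zero ι, mul_zero]
        intro hj'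
        apply hs.2
        -- Two such indices would put a nonzero multiple of `ι v` in the span; dividing by `j - i`
        -- is why the ambient space is rational.
        have h1 : ι (y - i • v) - ι (y - j • v) = ((j : ℚ) - i) • ι v := by
          rw [sub_smul, Nat.cast_smul_eq_nsmul, Nat.cast_smul_eq_nsmul, ← map_sub]
          simp
        have h2 := sub_mem hi hj'
        rw [h1] at h2
        refine (Submodule.smul_mem_iff _ ?_).mp h2
        rw [sub_ne_zero]
        exact_mod_cast hj
    · push Not at h
      have : ∀ i : ℕ, ((i ! : ℕ) : ℝ≥0∞)⁻¹ * (c v : ℝ≥0∞) ^ i *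
          expKernel (weightSum s c) (y - i • v) = 0 := fun i => by
        rw [expKernel_weightSum_eq_zero ι _ _ _ (h i), mul_zero]
      simp [this]

/-- Each extra generator convolves with a measure of total mass `exp (c v)`, which multiplies a
uniform bound by at most that mass. -/
theorem expKernel_weightSum_add_le [DecidableEq G] (c : G → ℝ≥0) (g : AddMonoidAlgebra ℝ≥0∞ G)
    (B : ℝ≥0∞) (hB : ∀ y, expKernel g y ≤ B) (s : Finset G) (y : G) :
    expKernel (weightSum s c + g) y ≤ (∏ v ∈ s, ENNReal.ofReal (Real.exp (c v))) * B := by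
  induction s using Finset.induction_on generalizing y with
  | empty => simpa [weightSum] using hB y
  | insert v s hv ih =>
    rw [weightSum_insert hv, add_assoc, expKernel_single_add, Finset.prod_insert hv, mul_assoc,
      ← tsum_inv_factorial_mul_pow, ← ENNReal.tsum_mul_right]
    exact ENNReal.tsum_le_tsum fun i => by gcongr; exact ih _

/-- Poisson weights of mean `c` are of order at most `c ^ (-1/2)`. For `i ≥ c/4` this is Stirling's
lower bound for `i!`; below `c/4` the weight is exponentially small, by comparison with the weight
of mean `c/2`. -/
theorem pow_div_factorial_le (c : ℝ) (hc : 0 < c) (i : ℕ) :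
    c ^ i / (i ! : ℕ) ≤ 2 * Real.exp c / Real.sqrt c := by
  have hsc : 0 < Real.sqrt c := Real.sqrt_pos.mpr hc
  have hi : (0 : ℝ) < (i ! : ℕ) := by positivity
  by_cases h : c / 4 ≤ i
  · have hi0 : (0 : ℝ) < i := lt_of_lt_of_le (by positivity) h
    -- The inequality `e * x ≤ exp x` at `x = c / i`; its `i`-th power bounds `(c e / i) ^ i` by
    -- `exp c`.
    have h1 : c / i * Real.exp 1 ≤ Real.exp (c / i) := by
      have := Real.add_one_le_exp (c / i - 1)
      have h2 : Real.exp (c / i) = Real.exp (c / i - 1) * Real.exp 1 := by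
        rw [← Real.exp_add]; simp
      rw [h2]
      gcongr
      linarith
    have h2 : (c / i * Real.exp 1) ^ i ≤ Real.exp c := by
      calc (c / i * Real.exp 1) ^ i ≤ Real.exp (c / i) ^ i := by gcongr
        _ = Real.exp c := by
          rw [← Real.exp_nat_mul]
          congr 1
          field_simp
    have h3 := Stirling.le_factorial_stirling i
    have h4 : Real.sqrt c ≤ Real.sqrt (2 * Real.pi * i) := by
      apply Real.sqrt_le_sqrt
      nlinarith [Real.pi_gt_three]
    have h5 : c ^ i = (c / i * Real.exp 1) ^ i * (i / Real.exp 1) ^ i := by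
      rw [← mul_pow]
      congr 1
      field_simp
    rw [div_le_div_iff₀ hi hsc, h5]
    calc (c / i * Real.exp 1) ^ i * (i / Real.exp 1) ^ i * Real.sqrt c
        ≤ Real.exp c * (i / Real.exp 1) ^ i * Real.sqrt (2 * Real.pi * i) := by gcongr
      _ = Real.exp c * (Real.sqrt (2 * Real.pi * i) * (i / Real.exp 1) ^ i) := by ring
      _ ≤ Real.exp c * (i ! : ℕ) := by gcongr
      _ ≤ 2 * Real.exp c * (i ! : ℕ) := by
        nlinarith [mul_pos (Real.exp_pos c) hi]
  · push Not at h
    have h1 : (c / 2) ^ i / (i ! : ℕ) ≤ Real.exp (c / 2) :=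
      Real.pow_div_factorial_le_exp _ (by positivity) _
    have h2 : (2 : ℝ) ^ i ≤ Real.exp (c / 4) := by
      calc (2 : ℝ) ^ i ≤ Real.exp 1 ^ i := by
            gcongr
            linarith [Real.add_one_le_exp (1 : ℝ)]
        _ = Real.exp i := by rw [← Real.exp_nat_mul, mul_one]
        _ ≤ _ := Real.exp_le_exp.mpr h.le
    have h3 : Real.sqrt c ≤ 2 * Real.exp (c / 4) := by
      rw [Real.sqrt_le_left (by positivity), mul_pow, ← Real.exp_nat_mul]
      have := Real.add_one_le_exp ((2 : ℕ) * (c / 4))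
      push_cast at *
      linarith
    have h4 : c ^ i = (c / 2) ^ i * 2 ^ i := by
      rw [← mul_pow]
      congr 1
      ring
    rw [le_div_iff₀ hsc, h4, mul_div_right_comm]
    calc (c / 2) ^ i / (i ! : ℕ) * 2 ^ i * Real.sqrt c
        ≤ Real.exp (c / 2) * Real.exp (c / 4) * (2 * Real.exp (c / 4)) := by gcongr
      _ = 2 * Real.exp c := by
        rw [show c = c / 2 + c / 4 + c / 4 by ring, Real.exp_add, Real.exp_add]
        ring_nf

theorem inv_factorial_mul_pow_le (c : ℝ≥0) (hc : 0 < c) (i : ℕ) :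
    ((i ! : ℕ) : ℝ≥0∞)⁻¹ * (c : ℝ≥0∞) ^ i ≤ ENNReal.ofReal (2 * Real.exp c / Real.sqrt c) := by
  rw [inv_factorial_mul_pow]
  exact ENNReal.ofReal_le_ofReal (pow_div_factorial_le c (by exact_mod_cast hc) i)

end BoltzmannGibbs

end

noncomputable section

namespace BoltzmannGibbs

open scoped Nat
open Finset.HasAntidiagonal (antidiagonal)

/-! ### The law of the walk as a group algebra exponential -/

variable {d : ℕ} {p : Site d → PMF (Site d)}

theorem IsAdmissible.finite_support (hp : IsAdmissible p) : (p 0).support.Finite := by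
  obtain ⟨R, -, hR⟩ := hp.finite_range
  refine (isCompact_closedBall (0 : Site d) R).finite_of_discrete.subset fun v hv => ?_
  by_contra h
  rw [mem_closedBall_zero_iff, not_le] at h
  exact hv (hR 0 v (by simpa using h))

/-- The finite set of the possible jumps. -/
def IsAdmissible.jumps (hp : IsAdmissible p) : Finset (Site d) := hp.finite_support.toFinset

theorem IsAdmissible.mem_jumps (hp : IsAdmissible p) {v : Site d} : v ∈ hp.jumps ↔ p 0 v ≠ 0 := by
  simp [IsAdmissible.jumps]

variable (p) in
/-- The jump probabilities as nonnegative real numbers. -/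
def jumpProb (v : Site d) : ℝ≥0 := (p 0 v).toNNReal

theorem coe_jumpProb (v : Site d) : (jumpProb p v : ℝ≥0∞) = p 0 v :=
  ENNReal.coe_toNNReal ((p 0).apply_ne_top v)

theorem IsAdmissible.sum_jumpProb (hp : IsAdmissible p) : ∑ v ∈ hp.jumps, jumpProb p v = 1 := by
  have h := (p 0).tsum_coe
  rw [tsum_eq_sum (s := hp.jumps) fun v hv => by
    simpa [hp.mem_jumps] using hv] at h
  rw [← ENNReal.coe_inj, ENNReal.ofNNReal_finsetSum]
  simpa [coe_jumpProb] using h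

/-- By translation invariance the increments are i.i.d., so the `n`-step law is the `n`-th
convolution power of the jump law. -/
theorem IsAdmissible.stepLaw_apply (hp : IsAdmissible p) (n : ℕ) (x y : Site d) :
    stepLaw p n x y = (weightSum hp.jumps (jumpProb p) ^ n).coeff (y - x) := by
  classical
  induction n generalizing x y with
  | zero =>
    simp [stepLaw, PMF.pure_apply, AddMonoidAlgebra.one_def, AddMonoidAlgebra.coeff_single,
      Finsupp.single_apply, sub_eq_zero, eq_comm]
  | succ n ih =>
    rw [stepLaw, PMF.bind_apply, pow_succ', weightSum, Finset.sum_mul, AddMonoidAlgebra.coeff_sum,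
      Finsupp.finsetSum_apply, ← (Equiv.addRight x).tsum_eq, tsum_eq_sum (s := hp.jumps)]
    · refine Finset.sum_congr rfl fun v _ => ?_
      rw [coeff_single_mul_sub, coe_jumpProb, hp.translation, ih, weightSum]
      simp [sub_sub, add_comm]
    · intro v hv
      rw [hp.translation]
      simp only [Equiv.coe_addRight, add_sub_cancel_right, mul_eq_zero]
      left
      simpa [hp.mem_jumps] using hv

theorem IsAdmissible.stepLaw_comm (hp : IsAdmissible p) (n : ℕ) (x y : Site d) :
    stepLaw p n x y = stepLaw p n y x := by
  -- Reflection invariance, inherited from a single jump; with translation invariance it yields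
  -- symmetry of the `n`-step law.
  have hneg : ∀ (n : ℕ) (x y : Site d), stepLaw p n (-x) (-y) = stepLaw p n x y := by
    intro n
    induction n with
    | zero =>
      intro x y
      classical
      simp [stepLaw, PMF.pure_apply]
    | succ n ih =>
      intro x y
      rw [stepLaw, PMF.bind_apply, stepLaw, PMF.bind_apply, ← (Equiv.neg (Site d)).tsum_eq]
      refine tsum_congr fun z => ?_
      simp only [Equiv.neg_apply]
      rw [ih, hp.symm x z, hp.translation, hp.translation z x]
      congr 2
      abel
  rw [hp.stepLaw_apply, ← hneg, hp.stepLaw_apply]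
  congr 1
  abel

theorem walkLaw_singleton (t : ℝ≥0) (x y : Site d) :
    walkLaw p t x {y} = ∑' n : ℕ, ENNReal.ofReal (Real.exp (-t)) *
      (((n ! : ℕ) : ℝ≥0∞)⁻¹ * (t : ℝ≥0∞) ^ n) * stepLaw p n x y := by
  rw [walkLaw, Measure.bind_apply (measurableSet_singleton y)
    (measurable_of_countable _).aemeasurable, lintegral_countable']
  refine tsum_congr fun n => ?_
  rw [PMF.toMeasure_apply_singleton _ _ (measurableSet_singleton y), poissonMeasure_singleton,
    mul_div_assoc, ENNReal.ofReal_mul (Real.exp_pos _).le, inv_factorial_mul_pow, mul_comm]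

theorem measurable_walkLaw_singleton (x y : Site d) :
    Measurable fun t : ℝ≥0 => walkLaw p t x {y} := by
  simp_rw [walkLaw_singleton]
  fun_prop

theorem IsAdmissible.walkLaw_comm (hp : IsAdmissible p) (t : ℝ≥0) (x y : Site d) :
    walkLaw p t x {y} = walkLaw p t y {x} := by
  simp_rw [walkLaw_singleton, hp.stepLaw_comm _ x y]

theorem tsum_walkLaw_singleton (t : ℝ≥0) (x : Site d) : ∑' y, walkLaw p t x {y} = 1 := by
  have := lintegral_countable' (μ := walkLaw p t x) (fun _ => 1)
  simpa using this.symm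

theorem smul_weightSum_pow (t : ℝ≥0) (s : Finset (Site d)) (c : Site d → ℝ≥0) (n : ℕ)
    (y : Site d) :
    (weightSum s (fun v => t * c v) ^ n).coeff y = (t : ℝ≥0∞) ^ n * (weightSum s c ^ n).coeff y := by
  have : weightSum s (fun v => t * c v) = (t : ℝ≥0∞) • weightSum s c := by
    rw [weightSum, weightSum, Finset.smul_sum]
    refine Finset.sum_congr rfl fun v _ => ?_
    rw [AddMonoidAlgebra.smul_single]
    simp
  rw [this, smul_pow, AddMonoidAlgebra.coeff_smul_apply, smul_eq_mul]

theorem IsAdmissible.walkLaw_eq_expKernel (hp : IsAdmissible p) (t : ℝ≥0) (x y : Site d) :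
    walkLaw p t x {y} = ENNReal.ofReal (Real.exp (-t)) *
      expKernel (weightSum hp.jumps fun v => t * jumpProb p v) (y - x) := by
  rw [walkLaw_singleton, expKernel, ← ENNReal.tsum_mul_left]
  refine tsum_congr fun n => ?_
  rw [hp.stepLaw_apply, smul_weightSum_pow]
  ring

/-- Embedding of the lattice into a rational vector space. -/
def latticeCast (d : ℕ) : Site d →+ (Fin d → ℚ) where
  toFun v i := v i
  map_zero' := by ext; simp
  map_add' _ _ := by ext; simp

/-- Irreducibility gives a path from `0` to `y`, whose increments are jumps. -/
theorem IsAdmissible.mem_span_jumps (hp : IsAdmissible p) (y : Site d) :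
    latticeCast d y ∈ Submodule.span ℚ (latticeCast d '' (hp.jumps : Set (Site d))) := by
  induction hp.irreducible 0 y with
  | refl => simp
  | @tail b c _ hbc ih =>
    have h : c - b ∈ hp.jumps := by
      rw [hp.mem_jumps, ← hp.translation]
      exact hbc.ne'
    have := add_mem ih (Submodule.subset_span (Set.mem_image_of_mem (latticeCast d) h))
    simpa using this

theorem IsAdmissible.exists_independent_jumps (hp : IsAdmissible p) :
    ∃ b : Finset (Site d), b ⊆ hp.jumps ∧ b.card = d ∧
      LinearIndepOn ℚ (latticeCast d) (b : Set (Site d)) := by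
  classical
  obtain ⟨b, hb, -, hspan, hind⟩ := exists_linearIndepOn_extension (K := ℚ) (v := latticeCast d)
    (linearIndepOn_empty ℚ _) (Set.empty_subset (hp.jumps : Set (Site d)))
  lift b to Finset (Site d) using hp.jumps.finite_toSet.subset hb
  refine ⟨b, by exact_mod_cast hb, ?_, hind⟩
  have htop : Submodule.span ℚ (latticeCast d '' (b : Set (Site d))) = ⊤ := by
    rw [eq_top_iff, ← (Pi.basisFun ℚ (Fin d)).span_eq, Submodule.span_le]
    rintro _ ⟨i, rfl⟩
    have h1 := Submodule.span_le.mpr hspan (hp.mem_span_jumps (Pi.single i 1))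
    convert! h1 using 1
    ext j
    simp [latticeCast, Pi.single_apply]
  have h1 := finrank_span_eq_card (R := ℚ) hind
  rw [← Set.image_eq_range, htop, finrank_top] at h1
  simpa using h1.symm

theorem IsAdmissible.exists_heatKernel_bound (hp : IsAdmissible p) :
    ∃ C : ℝ, 0 < C ∧ ∀ (t : ℝ≥0) (x y : Site d), 0 < t →
      walkLaw p t x {y} ≤ ENNReal.ofReal (C * ((Real.sqrt t)⁻¹) ^ d) := by
  classical
  obtain ⟨b, hb, hcard, hind⟩ := hp.exists_independent_jumps
  have hpos : ∀ v ∈ b, 0 < jumpProb p v := fun v hv => by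
    rw [pos_iff_ne_zero, ← ENNReal.coe_ne_coe, coe_jumpProb]
    exact hp.mem_jumps.mp (hb hv)
  -- One factor per independent jump, from `pow_div_factorial_le` with mean `t * jumpProb p v`; the
  -- factors `t ^ (-1/2)` are split off, and there are `d` of them.
  refine ⟨∏ v ∈ b, (2 / Real.sqrt (jumpProb p v)), Finset.prod_pos fun v hv => ?_, ?_⟩
  · have := hpos v hv
    have : 0 < Real.sqrt (jumpProb p v) := Real.sqrt_pos.mpr (by exact_mod_cast this)
    positivity
  intro t x y ht
  set c : Site d → ℝ≥0 := fun v => t * jumpProb p v with hc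
  have hsplit : weightSum hp.jumps c = weightSum (hp.jumps \ b) c + weightSum b c :=
    (Finset.sum_sdiff hb).symm
  -- The value `⊤` off `b` makes the required bound hold for every `v`; it never enters the product
  -- over `b`.
  set M : Site d → ℝ≥0∞ := fun v =>
    if v ∈ b then ENNReal.ofReal (2 * Real.exp (c v) / Real.sqrt (c v)) else ⊤ with hM
  have h1 : ∀ y, expKernel (weightSum b c) y ≤ ∏ v ∈ b, M v := by
    refine expKernel_weightSum_le_prod (latticeCast d) c M (fun v i => ?_) b hind
    rw [hM]
    dsimp only
    split_ifs with h
    · exact inv_factorial_mul_pow_le _ (mul_pos ht (hpos v h)) i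
    · exact le_top
  have h2 := expKernel_weightSum_add_le c _ _ h1 (hp.jumps \ b) (y - x)
  rw [hp.walkLaw_eq_expKernel]
  rw [← hsplit] at h2
  refine (mul_le_mul_right h2 _).trans (le_of_eq ?_)
  have h3 : ∏ v ∈ b, M v = ∏ v ∈ b, ENNReal.ofReal (2 * Real.exp (c v) / Real.sqrt (c v)) :=
    Finset.prod_congr rfl fun v hv => if_pos hv
  rw [h3, ← ENNReal.ofReal_prod_of_nonneg fun v _ => (Real.exp_pos _).le,
    ← ENNReal.ofReal_prod_of_nonneg fun v _ => by positivity,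
    ← ENNReal.ofReal_mul (by positivity), ← ENNReal.ofReal_mul (by positivity)]
  congr 1
  have h4 : ∀ v, 2 * Real.exp (c v) / Real.sqrt (c v)
      = 2 / Real.sqrt (jumpProb p v) * (Real.sqrt t)⁻¹ * Real.exp (c v) := by
    intro v
    rw [hc]
    push_cast
    rw [Real.sqrt_mul t.coe_nonneg]
    simp only [div_eq_mul_inv, mul_inv]
    ring
  simp_rw [h4]
  rw [Finset.prod_mul_distrib, Finset.prod_mul_distrib, Finset.prod_const, hcard]
  -- The jump probabilities sum to one, so all exponential factors together cancel the prefactor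
  -- `exp (-t)`.
  have h5 : (∏ v ∈ hp.jumps \ b, Real.exp (c v)) * ∏ v ∈ b, Real.exp (c v) = Real.exp t := by
    rw [Finset.prod_sdiff hb, ← Real.exp_sum]
    congr 1
    have := hp.sum_jumpProb
    rw [hc]
    push_cast
    rw [← Finset.mul_sum]
    have h6 : ∑ v ∈ hp.jumps, (jumpProb p v : ℝ) = 1 := by exact_mod_cast this
    rw [h6, mul_one]
  rw [mul_left_comm _ _ (∏ v ∈ b, Real.exp _), h5, mul_left_comm, ← Real.exp_add]
  simp

end BoltzmannGibbs

end

noncomputable section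

namespace BoltzmannGibbs

open scoped Nat

variable {d : ℕ} {p : Site d → PMF (Site d)}

/-! ### Exponential moments and the growth of the density -/

/-- A multiplicative `χ` factors over the independent increments. Averaging over the Poisson number
of jumps then gives `exp (t (E - 1))` below. -/
theorem IsAdmissible.tsum_stepLaw_mul (hp : IsAdmissible p) (χ : Site d → ℝ≥0∞) (h0 : χ 0 = 1)
    (hχ : ∀ u v, χ (u + v) = χ u * χ v) (n : ℕ) (x : Site d) :
    ∑' y, stepLaw p n x y * χ (y - x) = (∑' v, p 0 v * χ v) ^ n := by
  induction n generalizing x with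
  | zero =>
    rw [tsum_eq_single x]
    · simp [stepLaw, h0]
    · intro y hy
      simp [stepLaw, PMF.pure_apply, hy]
  | succ n ih =>
    have h : ∀ y, stepLaw p (n + 1) x y * χ (y - x)
        = ∑' z, p x z * χ (z - x) * (stepLaw p n z y * χ (y - z)) := by
      intro y
      rw [stepLaw, PMF.bind_apply, ← ENNReal.tsum_mul_right]
      refine tsum_congr fun z => ?_
      rw [show y - x = (z - x) + (y - z) by abel, hχ]
      ring
    simp_rw [h]
    rw [ENNReal.tsum_comm]
    simp_rw [ENNReal.tsum_mul_left, ih]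
    rw [ENNReal.tsum_mul_right, pow_succ']
    congr 1
    rw [← (Equiv.addRight x).tsum_eq]
    refine tsum_congr fun v => ?_
    rw [hp.translation]
    simp

theorem IsAdmissible.tsum_walkLaw_mul_le (hp : IsAdmissible p) (χ : Site d → ℝ≥0∞)
    (h0 : χ 0 = 1) (hχ : ∀ u v, χ (u + v) = χ u * χ v) (E : ℝ≥0)
    (hE : ∑' v, p 0 v * χ v ≤ E) (t : ℝ≥0) (x : Site d) :
    ∑' y, walkLaw p t x {y} * χ (y - x) ≤ ENNReal.ofReal (Real.exp (t * (E - 1))) := by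
  simp_rw [walkLaw_singleton, ← ENNReal.tsum_mul_right]
  rw [ENNReal.tsum_comm]
  have h : ∀ n : ℕ, ∑' y, ENNReal.ofReal (Real.exp (-t)) *
      (((n ! : ℕ) : ℝ≥0∞)⁻¹ * (t : ℝ≥0∞) ^ n) * stepLaw p n x y * χ (y - x)
      ≤ ENNReal.ofReal (Real.exp (-t)) * (((n ! : ℕ) : ℝ≥0∞)⁻¹ * ((t * E : ℝ≥0) : ℝ≥0∞) ^ n) := by
    intro n
    simp_rw [mul_assoc _ (stepLaw p n x _)]
    rw [ENNReal.tsum_mul_left, hp.tsum_stepLaw_mul χ h0 hχ, ENNReal.coe_mul, mul_pow, mul_assoc,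
      mul_assoc]
    gcongr
  refine (ENNReal.tsum_le_tsum h).trans (le_of_eq ?_)
  rw [ENNReal.tsum_mul_left, tsum_inv_factorial_mul_pow, ← ENNReal.ofReal_mul (Real.exp_pos _).le,
    ← Real.exp_add]
  congr 2
  push_cast
  ring

/-- Symmetry of the jumps replaces the exponential by `cosh x ≤ exp (x ^ 2 / 2)`. The absence of a
first-order term in `θ` is what makes times of order `N ^ 2` harmless when `θ` has order `1 / N`. -/
theorem IsAdmissible.tsum_jump_exp_le (hp : IsAdmissible p) {R : ℝ}
    (hR : ∀ v : Site d, R < ‖v‖ → p 0 v = 0) (θ : ℝ) (i : Fin d) :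
    ∑' v, p 0 v * ENNReal.ofReal (Real.exp (θ * v i))
      ≤ ENNReal.ofReal (Real.exp (θ ^ 2 * R ^ 2 / 2)) := by
  set χ : Site d → ℝ≥0∞ := fun v => ENNReal.ofReal (Real.exp (θ * v i)) with hχ
  set m := ∑' v, p 0 v * χ v with hm
  have h1 : m = ∑' v, p 0 v * χ (-v) := by
    rw [hm, ← (Equiv.neg (Site d)).tsum_eq]
    refine tsum_congr fun v => ?_
    rw [Equiv.neg_apply, hp.symm 0 (-v), hp.translation (-v) 0, sub_neg_eq_add, zero_add]
  have h2 : m + m ≤ 2 * ENNReal.ofReal (Real.exp (θ ^ 2 * R ^ 2 / 2)) := by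
    nth_rw 2 [h1]
    rw [hm, ← ENNReal.tsum_add]
    calc ∑' v, (p 0 v * χ v + p 0 v * χ (-v))
        ≤ ∑' v, p 0 v * (2 * ENNReal.ofReal (Real.exp (θ ^ 2 * R ^ 2 / 2))) := by
          refine ENNReal.tsum_le_tsum fun v => ?_
          rw [← mul_add]
          by_cases hv : R < ‖v‖
          · simp [hR v hv]
          push Not at hv
          gcongr
          rw [hχ]
          dsimp only
          rw [← ENNReal.ofReal_add (Real.exp_pos _).le (Real.exp_pos _).le,
            ← ENNReal.ofReal_ofNat 2, ← ENNReal.ofReal_mul (by norm_num)]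
          apply ENNReal.ofReal_le_ofReal
          have h3 := Real.cosh_le_exp_half_sq (θ * v i)
          rw [Real.cosh_eq] at h3
          have h4 : (v i : ℝ) ^ 2 ≤ R ^ 2 := by
            have h5 : |(v i : ℝ)| ≤ R := by
              have := (norm_le_pi_norm v i).trans hv
              rwa [Int.norm_eq_abs] at this
            exact sq_le_sq' (by linarith [neg_abs_le (v i : ℝ)]) (by linarith [le_abs_self (v i : ℝ)])
          have h6 : Real.exp ((θ * v i) ^ 2 / 2) ≤ Real.exp (θ ^ 2 * R ^ 2 / 2) := by
            rw [mul_pow]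
            gcongr
          have h7 : θ * ((-v) i : ℤ) = -(θ * v i) := by simp
          rw [h7]
          linarith
      _ = _ := by rw [ENNReal.tsum_mul_right, PMF.tsum_coe, one_mul]
  rw [← two_mul] at h2
  exact (ENNReal.mul_le_mul_iff_right (by norm_num) (by norm_num)).mp h2

theorem norm_macro_point_le (N : ℕ) (v : Site d) :
    ‖macro_point N v‖ ≤ ∑ i, |(v i : ℝ) / N| := by
  rw [EuclideanSpace.norm_eq]
  refine Real.sqrt_le_iff.mpr ⟨Finset.sum_nonneg fun _ _ => abs_nonneg _, ?_⟩
  simpa only [macro_point, Real.norm_eq_abs] using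
    Finset.sum_sq_le_sq_sum_of_nonneg (s := Finset.univ) (f := fun i => |(v i : ℝ) / N|)
      fun _ _ => abs_nonneg _

theorem macro_point_add (N : ℕ) (u v : Site d) :
    macro_point N (u + v) = macro_point N u + macro_point N v := by
  ext i
  simp [macro_point, add_div]

theorem exp_norm_macro_point_le (hd : 1 ≤ d) (N : ℕ) (v : Site d) :
    Real.exp ‖macro_point N v‖ ≤
      ∑ i, (Real.exp ((d : ℝ) / N * v i) + Real.exp (-((d : ℝ) / N) * v i)) := by
  have : Nonempty (Fin d) := ⟨⟨0, hd⟩⟩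
  obtain ⟨j, -, hj⟩ := Finset.exists_max_image Finset.univ (fun i => |(v i : ℝ) / N|)
    Finset.univ_nonempty
  have h1 : ‖macro_point N v‖ ≤ d * |(v j : ℝ) / N| := by
    refine (norm_macro_point_le N v).trans ((Finset.sum_le_card_nsmul _ _ _ hj).trans ?_)
    simp
  have h2 : Real.exp (d * |(v j : ℝ) / N|)
      ≤ Real.exp ((d : ℝ) / N * v j) + Real.exp (-((d : ℝ) / N) * v j) := by
    rcases abs_cases ((v j : ℝ) / N) with ⟨h, -⟩ | ⟨h, -⟩
    · rw [h, show (d : ℝ) * ((v j : ℝ) / N) = (d : ℝ) / N * v j by ring]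
      linarith [Real.exp_pos (-((d : ℝ) / N) * v j)]
    · rw [h, show (d : ℝ) * -((v j : ℝ) / N) = -((d : ℝ) / N) * v j by ring]
      linarith [Real.exp_pos ((d : ℝ) / N * v j)]
  refine (Real.exp_le_exp.mpr h1).trans (h2.trans ?_)
  exact Finset.single_le_sum
    (f := fun i => Real.exp ((d : ℝ) / N * v i) + Real.exp (-((d : ℝ) / N) * v i))
    (fun i _ => by positivity) (Finset.mem_univ j)

theorem one_add_pow_le_factorial_mul_exp (m : ℕ) {s : ℝ} (hs : 0 ≤ s) :
    (1 + s) ^ m ≤ (m ! : ℕ) * Real.exp 1 * Real.exp s := by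
  have h := Real.pow_div_factorial_le_exp (1 + s) (by positivity) m
  rw [div_le_iff₀ (by positivity), Real.exp_add] at h
  linarith

/-- Diffusively rescaled moments of the walk are bounded uniformly in the scaling parameter. -/
theorem IsAdmissible.exists_moment_bound (hp : IsAdmissible p) (hd : 1 ≤ d) (m : ℕ) (T : ℝ)
    (hT : 0 ≤ T) :
    ∃ B : ℝ, 0 ≤ B ∧ ∀ (N : ℕ) (t : ℝ≥0) (x : Site d), 1 ≤ N → (t : ℝ) ≤ (N : ℝ) ^ 2 * T →
      ∑' y, walkLaw p t x {y} * ENNReal.ofReal ((1 + ‖macro_point N (y - x)‖) ^ m)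
        ≤ ENNReal.ofReal B := by
  obtain ⟨R, -, hR⟩ := hp.finite_range
  have hR' : ∀ v : Site d, R < ‖v‖ → p 0 v = 0 := fun v hv => hR 0 v (by simpa using hv)
  set b : ℝ := (d : ℝ) ^ 2 * R ^ 2 / 2 with hb
  have hb0 : 0 ≤ b := by positivity
  set E : ℝ := Real.exp (T * (b * Real.exp b)) with hE
  have hE0 : 0 < E := Real.exp_pos _
  refine ⟨(m ! : ℕ) * Real.exp 1 * (∑ _i : Fin d, (E + E)), by positivity, ?_⟩
  intro N t x hN ht
  have hN' : (1 : ℝ) ≤ N := by exact_mod_cast hN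
  have key : ∀ (θ : ℝ) (i : Fin d), θ ^ 2 = ((d : ℝ) / N) ^ 2 →
      ∑' y, walkLaw p t x {y} * ENNReal.ofReal (Real.exp (θ * ((y - x) i : ℤ)))
        ≤ ENNReal.ofReal E := by
    intro θ i hθ
    set u := θ ^ 2 * R ^ 2 / 2 with hu
    have hu' : u = b / (N : ℝ) ^ 2 := by
      rw [hu, hθ, hb]
      field_simp
    have hu0 : 0 ≤ u := by positivity
    have hub : u ≤ b := by
      rw [hu']
      exact div_le_self hb0 (one_le_pow₀ hN')
    refine (hp.tsum_walkLaw_mul_le (fun v => ENNReal.ofReal (Real.exp (θ * v i))) (by simp) ?_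
      (Real.toNNReal (Real.exp u)) ?_ t x).trans ?_
    · intro v w
      rw [← ENNReal.ofReal_mul (Real.exp_pos _).le, ← Real.exp_add]
      simp [mul_add]
    · exact hp.tsum_jump_exp_le hR' θ i
    · apply ENNReal.ofReal_le_ofReal
      rw [hE, Real.exp_le_exp]
      rw [Real.coe_toNNReal _ (Real.exp_pos _).le]
      -- Since `u = b / N ^ 2` and `t ≤ N ^ 2 * T`, this linear bound makes the powers of `N` cancel
      -- in `t * (exp u - 1)`.
      have h1 : Real.exp u - 1 ≤ u * Real.exp u := by
        have h2 := Real.add_one_le_exp (-u)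
        have h3 : Real.exp (-u) * Real.exp u = 1 := by rw [← Real.exp_add]; simp
        nlinarith [Real.exp_pos u]
      calc (t : ℝ) * (Real.exp u - 1) ≤ (N : ℝ) ^ 2 * T * (u * Real.exp b) := by
            have h4 : u * Real.exp u ≤ u * Real.exp b := by gcongr
            have h5 : 0 ≤ Real.exp u - 1 := by linarith [Real.add_one_le_exp u]
            exact mul_le_mul ht (h1.trans h4) h5 (by positivity)
        _ = T * (b * Real.exp b) := by
            rw [hu']
            field_simp
  have h1 : ∀ y, ENNReal.ofReal ((1 + ‖macro_point N (y - x)‖) ^ m) ≤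
      ENNReal.ofReal ((m ! : ℕ) * Real.exp 1) *
        ∑ i, (ENNReal.ofReal (Real.exp ((d : ℝ) / N * ((y - x) i : ℤ))) +
          ENNReal.ofReal (Real.exp (-((d : ℝ) / N) * ((y - x) i : ℤ)))) := by
    intro y
    have h2 := (one_add_pow_le_factorial_mul_exp m (norm_nonneg (macro_point N (y - x)))).trans
      (mul_le_mul_of_nonneg_left (exp_norm_macro_point_le hd N (y - x)) (by positivity))
    refine (ENNReal.ofReal_le_ofReal h2).trans (le_of_eq ?_)
    rw [ENNReal.ofReal_mul (by positivity), ENNReal.ofReal_sum_of_nonneg fun i _ => by positivity]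
    congr 1
    refine Finset.sum_congr rfl fun i _ => ?_
    rw [ENNReal.ofReal_add (Real.exp_pos _).le (Real.exp_pos _).le]
  calc ∑' y, walkLaw p t x {y} * ENNReal.ofReal ((1 + ‖macro_point N (y - x)‖) ^ m)
      ≤ ∑' y, walkLaw p t x {y} * (ENNReal.ofReal ((m ! : ℕ) * Real.exp 1) *
        ∑ i, (ENNReal.ofReal (Real.exp ((d : ℝ) / N * ((y - x) i : ℤ))) +
          ENNReal.ofReal (Real.exp (-((d : ℝ) / N) * ((y - x) i : ℤ))))) :=
        ENNReal.tsum_le_tsum fun y => by gcongr; exact h1 y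
    _ = ENNReal.ofReal ((m ! : ℕ) * Real.exp 1) * ∑ i,
        ((∑' y, walkLaw p t x {y} * ENNReal.ofReal (Real.exp ((d : ℝ) / N * ((y - x) i : ℤ)))) +
        ∑' y, walkLaw p t x {y} *
          ENNReal.ofReal (Real.exp (-((d : ℝ) / N) * ((y - x) i : ℤ)))) := by
        simp_rw [mul_left_comm (walkLaw p t x _)]
        rw [ENNReal.tsum_mul_left]
        simp_rw [Finset.mul_sum]
        rw [Summable.tsum_finsetSum fun _ _ => ENNReal.summable, Finset.mul_sum]
        refine Finset.sum_congr rfl fun i _ => ?_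
        simp_rw [mul_add]
        rw [ENNReal.tsum_add, mul_add]
    _ ≤ ENNReal.ofReal ((m ! : ℕ) * Real.exp 1) *
          ∑ _i : Fin d, (ENNReal.ofReal E + ENNReal.ofReal E) := by
        gcongr with i
        · exact key _ i rfl
        · exact key _ i (by ring)
    _ = _ := by
        rw [ENNReal.ofReal_mul (p := (m ! : ℕ) * Real.exp 1) (by positivity),
          ENNReal.ofReal_sum_of_nonneg fun i _ => by positivity, ENNReal.ofReal_add hE0.le hE0.le]

/-- The density as an extended nonnegative real number. -/
def densityE {d : ℕ} (p : Site d → PMF (Site d)) (ρ : EuclideanSpace ℝ (Fin d) → ℝ≥0) (N : ℕ)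
    (t : ℝ≥0) (x : Site d) : ℝ≥0∞ :=
  ∑' y, walkLaw p t x {y} * (ρ (macro_point N y) : ℝ≥0∞)

theorem density_eq_toReal (ρ : EuclideanSpace ℝ (Fin d) → ℝ≥0) (N : ℕ) (t : ℝ≥0) (x : Site d) :
    density p ρ N t x = (densityE p ρ N t x).toReal := by
  rw [density, integral_eq_lintegral_of_nonneg_ae (ae_of_all _ fun _ => NNReal.coe_nonneg _)
    (measurable_of_countable _).aestronglyMeasurable, lintegral_countable', densityE]
  simp_rw [ENNReal.ofReal_coe_nnreal, mul_comm]

theorem measurable_densityE (ρ : EuclideanSpace ℝ (Fin d) → ℝ≥0) (N : ℕ) (x : Site d) :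
    Measurable fun t => densityE p ρ N t x := by
  unfold densityE
  exact Measurable.tsum fun y => (measurable_walkLaw_singleton x y).mul_const _

theorem one_add_norm_add_le {E : Type*} [SeminormedAddCommGroup E] (u v : E) :
    1 + ‖u + v‖ ≤ (1 + ‖u‖) * (1 + ‖v‖) := by
  nlinarith [norm_add_le u v, norm_nonneg u, norm_nonneg v]

/-- The weight `1 + ‖u‖` is submultiplicative under addition, so averaging a profile of growth `m`
over the walk costs only an `m`-th moment of the rescaled displacement. The bound is uniform in `N`
and in the time window. -/
theorem IsAdmissible.exists_densityE_bound (hp : IsAdmissible p) (hd : 1 ≤ d)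
    {ρ : EuclideanSpace ℝ (Fin d) → ℝ≥0} {A : ℝ} {m : ℕ}
    (hρ : ∀ u, (ρ u : ℝ) ≤ A * (1 + ‖u‖) ^ m) (T : ℝ) (hT : 0 ≤ T) :
    ∃ B : ℝ, 0 ≤ B ∧ ∀ (N : ℕ) (t : ℝ≥0) (x : Site d), 1 ≤ N → (t : ℝ) ≤ (N : ℝ) ^ 2 * T →
      densityE p ρ N t x ≤ ENNReal.ofReal (B * (1 + ‖macro_point N x‖) ^ m) := by
  obtain ⟨B, hB0, hB⟩ := hp.exists_moment_bound hd m T hT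
  have hA : 0 ≤ A := by
    have := (ρ 0).coe_nonneg.trans (hρ 0)
    simpa using this
  refine ⟨A * B, by positivity, fun N t x hN ht => ?_⟩
  calc densityE p ρ N t x
      ≤ ∑' y, walkLaw p t x {y} * (ENNReal.ofReal (A * (1 + ‖macro_point N x‖) ^ m) *
          ENNReal.ofReal ((1 + ‖macro_point N (y - x)‖) ^ m)) := by
        refine ENNReal.tsum_le_tsum fun y => ?_
        gcongr
        rw [← ENNReal.ofReal_mul (by positivity), ← ENNReal.ofReal_coe_nnreal]
        apply ENNReal.ofReal_le_ofReal
        refine (hρ _).trans ?_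
        rw [mul_assoc, ← mul_pow]
        gcongr
        conv_lhs => rw [← add_sub_cancel x y, macro_point_add]
        exact one_add_norm_add_le _ _
    _ = ENNReal.ofReal (A * (1 + ‖macro_point N x‖) ^ m) *
          ∑' y, walkLaw p t x {y} * ENNReal.ofReal ((1 + ‖macro_point N (y - x)‖) ^ m) := by
        rw [← ENNReal.tsum_mul_left]
        exact tsum_congr fun y => by ring
    _ ≤ ENNReal.ofReal (A * (1 + ‖macro_point N x‖) ^ m) * ENNReal.ofReal B := by
        gcongr
        exact hB N t x hN ht
    _ = _ := by
        rw [← ENNReal.ofReal_mul (by positivity)]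
        congr 1
        ring

end BoltzmannGibbs

end

noncomputable section

namespace BoltzmannGibbs

open scoped Nat

variable {d : ℕ}

/-! ### Charlier polynomials and factorial moments -/

/-- Pairs `(g, v)` of a polynomial function `g` on `ℕ` and of its mean `v` with respect to the
Poisson distribution with parameter `r`, both expressed through falling factorials. -/
def poissonMean (r : ℝ) : Submodule ℝ ((ℕ → ℝ) × ℝ) :=
  Submodule.span ℝ (Set.range fun m : ℕ => ((fun n : ℕ => (n.descFactorial m : ℝ)), r ^ m))

theorem descFactorial_mem_poissonMean (r : ℝ) (m : ℕ) :
    ((fun n : ℕ => (n.descFactorial m : ℝ)), r ^ m) ∈ poissonMean r :=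
  Submodule.subset_span ⟨m, rfl⟩

theorem natCast_mul_descFactorial_pred (n m : ℕ) :
    (n : ℝ) * ((n - 1).descFactorial m : ℝ) = (n.descFactorial (m + 1) : ℝ) := by
  cases n with
  | zero => simp
  | succ n => rw [Nat.succ_descFactorial_succ]; simp

/-- The Chen–Stein identity `E[n g(n - 1)] = r E[g(n)]`, which on falling factorials just raises the
degree by one. -/
theorem shift_mem_poissonMean {r : ℝ} {q : (ℕ → ℝ) × ℝ} (hq : q ∈ poissonMean r) :
    ((fun n : ℕ => (n : ℝ) * q.1 (n - 1)), r * q.2) ∈ poissonMean r := by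
  induction hq using Submodule.span_induction with
  | mem q hq =>
    obtain ⟨m, rfl⟩ := hq
    simp only [natCast_mul_descFactorial_pred, ← pow_succ']
    exact descFactorial_mem_poissonMean r (m + 1)
  | zero =>
    convert zero_mem (poissonMean r) using 1
    ext <;> simp
  | add q q' _ _ h h' =>
    convert add_mem h h' using 1
    ext <;> simp [mul_add]
  | smul c q _ h =>
    convert Submodule.smul_mem _ c h using 1
    ext <;> simp [mul_left_comm]

theorem charlier_succ (r : ℝ) (k n : ℕ) :
    charlier r (k + 1) n = n * charlier r k (n - 1) - r * charlier r k n := by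
  have h1 : (n : ℝ) * charlier r k (n - 1) = ∑ j ∈ Finset.range (k + 1),
      (k.choose j : ℝ) * (-r) ^ (k - j) * (n.descFactorial (j + 1) : ℝ) := by
    rw [charlier, Finset.mul_sum]
    refine Finset.sum_congr rfl fun j _ => ?_
    rw [← natCast_mul_descFactorial_pred]
    ring
  have h2 : -(r * charlier r k n) = ∑ j ∈ Finset.range (k + 2),
      (k.choose j : ℝ) * (-r) ^ (k + 1 - j) * (n.descFactorial j : ℝ) := by
    rw [Finset.sum_range_succ, Nat.choose_succ_self, charlier, Finset.mul_sum,
      ← Finset.sum_neg_distrib]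
    simp only [Nat.cast_zero, zero_mul, add_zero]
    refine Finset.sum_congr rfl fun j hj => ?_
    rw [Nat.sub_add_comm (Nat.lt_succ_iff.mp (Finset.mem_range.mp hj)), pow_succ]
    ring
  rw [sub_eq_add_neg, h1, h2, charlier, Finset.sum_range_succ', Finset.sum_range_succ' _ (k + 1),
    ← add_assoc, ← Finset.sum_add_distrib]
  congr 1
  · refine Finset.sum_congr rfl fun j _ => ?_
    rw [Nat.choose_succ_succ, Nat.add_sub_add_right]
    push_cast
    ring
  · simp

theorem descFactorial_succ_left (n j : ℕ) :
    ((n + 1).descFactorial j : ℝ) = n.descFactorial j + j * n.descFactorial (j - 1) := by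
  cases j with
  | zero => simp
  | succ j =>
    rw [Nat.succ_descFactorial_succ, Nat.descFactorial_succ]
    simp only [Nat.cast_mul, Nat.add_sub_cancel]
    rcases le_or_gt j n with h | h
    · push_cast [h]
      ring
    · rw [Nat.descFactorial_eq_zero_iff_lt.mpr h]
      simp

/-- Summation by parts: by `charlier_succ` and the Chen–Stein identity, each degree of the Charlier
polynomial trades for `r` times a forward difference of the other factor, and the difference of a
falling factorial of degree `j` is `j` times the one of degree `j - 1`. The mean vanishes for `j <
k`, which is orthogonality. -/
theorem charlier_mul_descFactorial_mem_poissonMean (r : ℝ) (k j : ℕ) :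
    ((fun n : ℕ => charlier r k n * (n.descFactorial j : ℝ)), (j.descFactorial k : ℝ) * r ^ j)
      ∈ poissonMean r := by
  induction k generalizing j with
  | zero => simpa [charlier] using descFactorial_mem_poissonMean r j
  | succ k ih =>
    have h := sub_mem (shift_mem_poissonMean (add_mem (ih j)
      (Submodule.smul_mem _ (j : ℝ) (ih (j - 1))))) (Submodule.smul_mem _ r (ih j))
    convert h using 1
    ext n
    · simp only [Prod.smul_mk, Prod.mk_add_mk, Pi.add_apply, Pi.smul_apply, smul_eq_mul,
        Prod.mk_sub_mk, Pi.sub_apply]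
      rw [charlier_succ]
      cases n with
      | zero => simp [mul_assoc]
      | succ n =>
        rw [descFactorial_succ_left n j]
        simp only [Nat.add_sub_cancel]
        ring
    · simp only [Prod.smul_mk, Prod.mk_add_mk, smul_eq_mul, Prod.mk_sub_mk]
      rw [← natCast_mul_descFactorial_pred]
      cases j with
      | zero => simp
      | succ j =>
        simp only [Nat.add_sub_cancel]
        ring

/-- Expand one factor in falling factorials: by orthogonality only its monic top term contributes to
the mean. -/
theorem charlier_sq_mem_poissonMean (r : ℝ) (k : ℕ) :
    ((fun n : ℕ => charlier r k n * charlier r k n), (k ! : ℝ) * r ^ k) ∈ poissonMean r := by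
  have h := Submodule.sum_mem (poissonMean r) (t := Finset.range (k + 1))
    (f := fun j => ((k.choose j : ℝ) * (-r) ^ (k - j)) •
      ((fun n : ℕ => charlier r k n * (n.descFactorial j : ℝ)), (j.descFactorial k : ℝ) * r ^ j))
    fun j _ => Submodule.smul_mem _ _ (charlier_mul_descFactorial_mem_poissonMean r k j)
  convert h using 1
  ext n
  · simp only [Prod.fst_sum, Finset.sum_apply, Prod.smul_fst, Pi.smul_apply, smul_eq_mul]
    conv_lhs => enter [2]; rw [charlier]
    rw [Finset.mul_sum]
    refine Finset.sum_congr rfl fun j _ => ?_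
    ring
  · simp only [Prod.snd_sum, Prod.smul_snd, smul_eq_mul]
    rw [Finset.sum_range_succ, Finset.sum_eq_zero]
    · simp [Nat.descFactorial_self]
    · intro j hj
      rw [Nat.descFactorial_eq_zero_iff_lt.mpr (Finset.mem_range.mp hj)]
      simp

/-- The value of the mean is irrelevant: this serves only to show that falling factorials are square
integrable. -/
theorem exists_descFactorial_mul_mem_poissonMean (r : ℝ) (j l : ℕ) :
    ∃ v, ((fun n : ℕ => (n.descFactorial j : ℝ) * (n.descFactorial l : ℝ)), v) ∈ poissonMean r := by
  induction j generalizing l with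
  | zero => exact ⟨_, by simpa using descFactorial_mem_poissonMean r l⟩
  | succ j ih =>
    obtain ⟨v, hv⟩ := ih (l + 1)
    obtain ⟨w, hw⟩ := ih l
    refine ⟨v + ((l : ℝ) - j) • w, ?_⟩
    convert add_mem hv (Submodule.smul_mem _ ((l : ℝ) - j) hw) using 1
    rw [Prod.smul_mk, Prod.mk_add_mk, Prod.mk.injEq]
    refine ⟨?_, rfl⟩
    ext n
    have h : ∀ m : ℕ, (n.descFactorial (m + 1) : ℝ) = ((n : ℝ) - m) * n.descFactorial m := by
      intro m
      rw [Nat.descFactorial_succ]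
      rcases le_or_gt m n with h | h
      · push_cast [h]
        ring
      · rw [Nat.descFactorial_eq_zero_iff_lt.mpr h]
        simp
    simp only [Pi.add_apply, Pi.smul_apply, smul_eq_mul, h]
    ring

/-- Product over the sites of the falling factorials of the occupation numbers. -/
def fallingProd (ξ : Site d →₀ ℕ) (η : Config d) : ℕ :=
  ξ.prod fun x k => (η x).descFactorial k

theorem measurable_fallingProd (ξ : Site d →₀ ℕ) :
    Measurable (fallingProd ξ : Config d → ℕ) := by
  unfold fallingProd Finsupp.prod
  exact Finset.measurable_fun_prod _ fun x _ =>
    (measurable_of_countable fun n : ℕ => n.descFactorial (ξ x)).comp (measurable_pi_apply x)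

theorem measurable_fallingProd_ennreal (ξ : Site d →₀ ℕ) :
    Measurable fun η : Config d => (fallingProd ξ η : ℝ≥0∞) :=
  (measurable_of_countable fun n : ℕ => (n : ℝ≥0∞)).comp (measurable_fallingProd ξ)

theorem measurable_fallingProd_real (ξ : Site d →₀ ℕ) :
    Measurable fun η : Config d => (fallingProd ξ η : ℝ) :=
  (measurable_of_countable fun n : ℕ => (n : ℝ)).comp (measurable_fallingProd ξ)

/-- The factorial moments of `μ` are those of the product of Poisson laws with means `r`. -/
def HasPoissonMoments (μ : Measure (Config d)) (r : Site d → ℝ≥0) : Prop :=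
  ∀ ξ : Site d →₀ ℕ, ∫⁻ η, (fallingProd ξ η : ℝ≥0∞) ∂μ = ξ.prod fun x k => (r x : ℝ≥0∞) ^ k

theorem fallingProd_add_single (ξ : Site d →₀ ℕ) {a : Site d} (ha : ξ a = 0) (m : ℕ)
    (η : Config d) :
    fallingProd (ξ + Finsupp.single a m) η = (η a).descFactorial m * fallingProd ξ η := by
  classical
  rw [fallingProd, Finsupp.prod_add_index_of_disjoint, mul_comm, Finsupp.prod_single_index (by simp)]
  · rfl
  · refine Finset.disjoint_of_subset_right Finsupp.support_single_subset ?_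
    simpa using ha

theorem HasPoissonMoments.integral_fallingProd {μ : Measure (Config d)} {r : Site d → ℝ≥0}
    (hμ : HasPoissonMoments μ r) (ξ : Site d →₀ ℕ) :
    Integrable (fun η => (fallingProd ξ η : ℝ)) μ ∧
      ∫ η, (fallingProd ξ η : ℝ) ∂μ = ξ.prod fun x k => (r x : ℝ) ^ k := by
  have h : ∫⁻ η, ENNReal.ofReal (fallingProd ξ η : ℝ) ∂μ
      = ((ξ.prod fun x k => r x ^ k : ℝ≥0) : ℝ≥0∞) := by
    simp_rw [ENNReal.ofReal_natCast]
    rw [hμ ξ]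
    simp [Finsupp.prod]
  constructor
  · refine ⟨(measurable_fallingProd_real ξ).aestronglyMeasurable, ?_⟩
    rw [hasFiniteIntegral_iff_ofReal (ae_of_all _ fun _ => Nat.cast_nonneg _), h]
    exact ENNReal.coe_lt_top
  · rw [integral_eq_lintegral_of_nonneg_ae (ae_of_all _ fun _ => Nat.cast_nonneg _)
      (measurable_fallingProd_real ξ).aestronglyMeasurable, h]
    simp [Finsupp.prod]

/-- No independence under `μ` is assumed. Sites are treated one at a time: by linearity the factor
at a site may be taken to be a falling factorial, which is then absorbed into `ξ`. -/
theorem HasPoissonMoments.integral_prod_mul_fallingProd {μ : Measure (Config d)}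
    {r : Site d → ℝ≥0} (hμ : HasPoissonMoments μ r) (g : Site d → ℕ → ℝ) (v : Site d → ℝ)
    (s : Finset (Site d)) (hg : ∀ x ∈ s, (g x, v x) ∈ poissonMean (r x))
    (ξ : Site d →₀ ℕ) (hξ : ∀ x ∈ s, ξ x = 0) :
    Integrable (fun η => (∏ x ∈ s, g x (η x)) * (fallingProd ξ η : ℝ)) μ ∧
      ∫ η, (∏ x ∈ s, g x (η x)) * (fallingProd ξ η : ℝ) ∂μ
        = (∏ x ∈ s, v x) * ξ.prod fun x k => (r x : ℝ) ^ k := by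
  classical
  induction s using Finset.induction_on generalizing ξ with
  | empty => simpa using hμ.integral_fallingProd ξ
  | insert a s ha ih =>
    have key : ∀ q ∈ poissonMean (r a),
        Integrable (fun η : Config d => q.1 (η a) * ((∏ x ∈ s, g x (η x)) * (fallingProd ξ η : ℝ))) μ ∧
        ∫ η, q.1 (η a) * ((∏ x ∈ s, g x (η x)) * (fallingProd ξ η : ℝ)) ∂μ
          = q.2 * ((∏ x ∈ s, v x) * ξ.prod fun x k => (r x : ℝ) ^ k) := by
      intro q hq
      induction hq using Submodule.span_induction with
      | mem q hq =>
        obtain ⟨m, rfl⟩ := hq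
        have ha0 : ξ a = 0 := hξ a (Finset.mem_insert_self a s)
        have h := ih (fun x hx => hg x (Finset.mem_insert_of_mem hx))
          (ξ + Finsupp.single a m) fun x hx => by
            have : x ≠ a := fun h => ha (h ▸ hx)
            simp [hξ x (Finset.mem_insert_of_mem hx), this.symm]
        have h1 : ∀ η : Config d, (∏ x ∈ s, g x (η x)) *
            (fallingProd (ξ + Finsupp.single a m) η : ℝ)
            = ((η a).descFactorial m : ℝ) * ((∏ x ∈ s, g x (η x)) * (fallingProd ξ η : ℝ)) := by
          intro η
          rw [fallingProd_add_single ξ ha0]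
          push_cast
          ring
        simp_rw [h1] at h
        refine ⟨h.1, h.2.trans ?_⟩
        rw [Finsupp.prod_add_index_of_disjoint, Finsupp.prod_single_index (by simp)]
        · ring
        · refine Finset.disjoint_of_subset_right Finsupp.support_single_subset ?_
          simpa using ha0
      | zero => simp
      | add q q' _ _ h h' =>
        simp only [Prod.fst_add, Pi.add_apply, add_mul, Prod.snd_add]
        refine ⟨h.1.add h'.1, ?_⟩
        rw [integral_add h.1 h'.1, h.2, h'.2]
      | smul c q _ h =>
        simp only [Prod.smul_fst, Pi.smul_apply, smul_eq_mul, Prod.smul_snd, mul_assoc]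
        refine ⟨h.1.const_mul c, ?_⟩
        rw [integral_const_mul, h.2]
    have h := key _ (hg a (Finset.mem_insert_self a s))
    simp_rw [Finset.prod_insert ha, mul_assoc]
    exact h

theorem HasPoissonMoments.integral_prod {μ : Measure (Config d)}
    {r : Site d → ℝ≥0} (hμ : HasPoissonMoments μ r) (g : Site d → ℕ → ℝ) (v : Site d → ℝ)
    (s : Finset (Site d)) (hg : ∀ x ∈ s, (g x, v x) ∈ poissonMean (r x)) :
    Integrable (fun η => ∏ x ∈ s, g x (η x)) μ ∧ ∫ η, ∏ x ∈ s, g x (η x) ∂μ = ∏ x ∈ s, v x := by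
  simpa [fallingProd] using hμ.integral_prod_mul_fallingProd g v s hg 0 (by simp)

theorem charlier_zero (r : ℝ) (n : ℕ) : charlier r 0 n = 1 := by simp [charlier]

theorem orthoPoly_eq_prod (r : Site d → ℝ) (ξ : Site d →₀ ℕ) {s : Finset (Site d)}
    (hs : ξ.support ⊆ s) (η : Config d) :
    orthoPoly r ξ η = ∏ x ∈ s, charlier (r x) (ξ x) (η x) :=
  Finsupp.prod_of_support_subset _ hs _ fun _ _ => charlier_zero _ _

theorem fallingProd_eq_prod (ξ : Site d →₀ ℕ) {s : Finset (Site d)}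
    (hs : ξ.support ⊆ s) (η : Config d) :
    fallingProd ξ η = ∏ x ∈ s, (η x).descFactorial (ξ x) :=
  Finsupp.prod_of_support_subset _ hs _ fun _ _ => Nat.descFactorial_zero _

theorem measurable_orthoPoly (r : Site d → ℝ) (ξ : Site d →₀ ℕ) :
    Measurable (orthoPoly r ξ : Config d → ℝ) := by
  unfold orthoPoly Finsupp.prod
  exact Finset.measurable_fun_prod _ fun x _ =>
    (measurable_of_countable (charlier (r x) (ξ x))).comp (measurable_pi_apply x)

/-- The squared norm of the orthogonal polynomial indexed by `ξ`. -/
def orthoNorm (r : Site d → ℝ≥0) (ξ : Site d →₀ ℕ) : ℝ := ξ.prod fun x k => (k ! : ℝ) * (r x : ℝ) ^ k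

theorem HasPoissonMoments.integral_orthoPoly_mul_fallingProd {μ : Measure (Config d)}
    {r : Site d → ℝ≥0} (hμ : HasPoissonMoments μ r) (ξ ξ' : Site d →₀ ℕ)
    (hle : ξ'.degree ≤ ξ.degree) [Decidable (ξ' = ξ)] :
    ∫ η, orthoPoly (fun x => (r x : ℝ)) ξ η * (fallingProd ξ' η : ℝ) ∂μ
      = if ξ' = ξ then orthoNorm r ξ else 0 := by
  classical
  have h := hμ.integral_prod
    (fun x n => charlier (r x) (ξ x) n * (n.descFactorial (ξ' x) : ℝ))
    (fun x => ((ξ' x).descFactorial (ξ x) : ℝ) * (r x : ℝ) ^ (ξ' x)) (ξ.support ∪ ξ'.support)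
    fun x _ => charlier_mul_descFactorial_mem_poissonMean (r x) (ξ x) (ξ' x)
  simp_rw [orthoPoly_eq_prod _ ξ (Finset.subset_union_left (s₂ := ξ'.support)),
    fallingProd_eq_prod ξ' (Finset.subset_union_right (s₁ := ξ.support)), Nat.cast_prod,
    ← Finset.prod_mul_distrib]
  rw [h.2]
  split_ifs with heq
  · subst heq
    rw [Finset.union_self, orthoNorm, Finsupp.prod]
    simp [Nat.descFactorial_self]
  -- Otherwise `ξ ≤ ξ'`, and the degree condition would force equality. At such a site the
  -- one-dimensional mean vanishes.
  · have hx : ∃ x, ξ' x < ξ x := by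
      by_contra hcon
      push Not at hcon
      have h1 : ξ ≤ ξ' := hcon
      obtain ⟨δ, rfl⟩ := le_iff_exists_add.mp h1
      rw [map_add] at hle
      have : δ.degree = 0 := by omega
      rw [Finsupp.degree_eq_zero_iff] at this
      simp [this] at heq
    obtain ⟨x, hx⟩ := hx
    refine Finset.prod_eq_zero (i := x) ?_ ?_
    · simp only [Finset.mem_union, Finsupp.mem_support_iff]
      left
      omega
    · rw [Nat.descFactorial_eq_zero_iff_lt.mpr hx]
      simp

theorem HasPoissonMoments.integral_orthoPoly_sq {μ : Measure (Config d)}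
    {r : Site d → ℝ≥0} (hμ : HasPoissonMoments μ r) (ξ : Site d →₀ ℕ) :
    Integrable (fun η => orthoPoly (fun x => (r x : ℝ)) ξ η ^ 2) μ ∧
      ∫ η, orthoPoly (fun x => (r x : ℝ)) ξ η ^ 2 ∂μ = orthoNorm r ξ := by
  have h := hμ.integral_prod _ _ ξ.support fun x _ => charlier_sq_mem_poissonMean (r x) (ξ x)
  simp_rw [← sq, Finset.prod_pow] at h
  exact h

theorem HasPoissonMoments.memLp_orthoPoly {μ : Measure (Config d)}
    {r : Site d → ℝ≥0} (hμ : HasPoissonMoments μ r) (ξ : Site d →₀ ℕ) :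
    MemLp (orthoPoly (fun x => (r x : ℝ)) ξ) 2 μ :=
  (memLp_two_iff_integrable_sq (measurable_orthoPoly _ _).aestronglyMeasurable).mpr
    (hμ.integral_orthoPoly_sq ξ).1

theorem HasPoissonMoments.memLp_fallingProd {μ : Measure (Config d)}
    {r : Site d → ℝ≥0} (hμ : HasPoissonMoments μ r) (ξ : Site d →₀ ℕ) :
    MemLp (fun η => (fallingProd ξ η : ℝ)) 2 μ := by
  refine (memLp_two_iff_integrable_sq (measurable_fallingProd_real ξ).aestronglyMeasurable).mpr ?_
  choose v hv using fun x : Site d => exists_descFactorial_mul_mem_poissonMean (r x) (ξ x) (ξ x)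
  have h := (hμ.integral_prod _ v ξ.support fun x _ => hv x).1
  simp_rw [Finset.prod_mul_distrib, ← sq] at h
  convert h using 3
  simp [fallingProd, Finsupp.prod]

/-- The linear span of the products of falling factorials of degree less than `n`. -/
def fallingSpan (d n : ℕ) : Submodule ℝ (Config d → ℝ) :=
  Submodule.span ℝ {f | ∃ ξ : Site d →₀ ℕ, ξ.degree < n ∧ f = fun η => (fallingProd ξ η : ℝ)}

theorem fallingSpan_mono {m n : ℕ} (h : m ≤ n) : fallingSpan d m ≤ fallingSpan d n :=
  Submodule.span_mono fun _ ⟨ξ, hξ, hf⟩ => ⟨ξ, hξ.trans_le h, hf⟩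

/-- Charlier polynomials are monic in the falling factorial basis. The auxiliary `ξ'` collects the
falling factorials chosen at the sites already expanded, so that the induction closes. -/
theorem prod_charlier_sub_mem_fallingSpan (r : Site d → ℝ) (ξ : Site d →₀ ℕ) (s : Finset (Site d))
    (ξ' : Site d →₀ ℕ) (hξ' : ∀ x ∈ s, ξ' x = 0) :
    (fun η : Config d => (∏ x ∈ s, charlier (r x) (ξ x) (η x)) * (fallingProd ξ' η : ℝ) -
      (fallingProd (ξ' + ∑ x ∈ s, Finsupp.single x (ξ x)) η : ℝ)) ∈
        fallingSpan d (ξ'.degree + ∑ x ∈ s, ξ x) := by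
  classical
  induction s using Finset.induction_on generalizing ξ' with
  | empty =>
    convert zero_mem (fallingSpan d _) using 1
    ext
    simp
  | insert a s ha ih =>
    have ha0 : ξ' a = 0 := hξ' a (Finset.mem_insert_self a s)
    have hj : ∀ j, (fun η : Config d => (∏ x ∈ s, charlier (r x) (ξ x) (η x)) *
        (fallingProd (ξ' + Finsupp.single a j) η : ℝ) -
        (fallingProd (ξ' + Finsupp.single a j + ∑ x ∈ s, Finsupp.single x (ξ x)) η : ℝ)) ∈
        fallingSpan d (ξ'.degree + j + ∑ x ∈ s, ξ x) := by
      intro j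
      have := ih (ξ' + Finsupp.single a j) fun x hx => by
            have : x ≠ a := fun h => ha (h ▸ hx)
            simp [hξ' x (Finset.mem_insert_of_mem hx), this.symm]
      rwa [map_add, Finsupp.degree_single] at this
    have hlow : ∀ j ∈ Finset.range (ξ a), (fun η : Config d =>
        (∏ x ∈ s, charlier (r x) (ξ x) (η x)) *
        (fallingProd (ξ' + Finsupp.single a j) η : ℝ)) ∈
        fallingSpan d (ξ'.degree + ∑ x ∈ insert a s, ξ x) := by
      intro j hja
      rw [Finset.mem_range] at hja
      rw [Finset.sum_insert ha]
      have h1 := fallingSpan_mono (n := ξ'.degree + (ξ a + ∑ x ∈ s, ξ x)) (by omega) (hj j)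
      have h2 : (fun η : Config d => (fallingProd (ξ' + Finsupp.single a j +
          ∑ x ∈ s, Finsupp.single x (ξ x)) η : ℝ)) ∈
          fallingSpan d (ξ'.degree + (ξ a + ∑ x ∈ s, ξ x)) := by
        refine Submodule.subset_span ⟨_, ?_, rfl⟩
        simp only [map_add, map_sum, Finsupp.degree_single]
        omega
      convert add_mem h1 h2 using 1
      ext η
      simp
    have htop := fallingSpan_mono (n := ξ'.degree + ∑ x ∈ insert a s, ξ x)
      (by rw [Finset.sum_insert ha]; omega) (hj (ξ a))
    have hsum := add_mem (Submodule.sum_mem _ fun j hj => Submodule.smul_mem _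
      (((ξ a).choose j : ℝ) * (-r a) ^ (ξ a - j)) (hlow j hj)) htop
    convert hsum using 1
    ext η
    simp only [Pi.add_apply, Finset.sum_apply, Pi.smul_apply, smul_eq_mul]
    rw [Finset.prod_insert ha, Finset.sum_insert ha, ← add_assoc, ← add_sub_assoc, charlier,
      Finset.sum_range_succ]
    congr 1
    simp only [fallingProd_add_single ξ' ha0, Nat.cast_mul, Nat.choose_self, Nat.sub_self, pow_zero]
    rw [mul_assoc, add_mul, Finset.sum_mul]
    congr 1
    · refine Finset.sum_congr rfl fun j _ => ?_
      ring
    · push_cast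
      ring

theorem orthoPoly_sub_fallingProd_mem_fallingSpan (r : Site d → ℝ) (ξ : Site d →₀ ℕ) :
    (fun η : Config d => orthoPoly r ξ η - (fallingProd ξ η : ℝ)) ∈ fallingSpan d ξ.degree := by
  have h := prod_charlier_sub_mem_fallingSpan r ξ ξ.support 0 (by simp)
  have h1 : ∑ x ∈ ξ.support, Finsupp.single x (ξ x) = ξ := ξ.sum_single
  simpa [h1, fallingProd, orthoPoly, Finsupp.prod, Finsupp.degree_apply] using h

end BoltzmannGibbs

end

noncomputable section

namespace BoltzmannGibbs

open scoped Nat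

variable {d : ℕ}

/-! ### Tuples of sites and tuples of particles -/

theorem toConfig_cons {k : ℕ} (y : Site d) (ys : Fin k → Site d) :
    toConfig (Fin.cons y ys : Fin (k + 1) → Site d) = Finsupp.single y 1 + toConfig ys := by
  simp [toConfig, Fin.sum_univ_succ]

theorem degree_toConfig {k : ℕ} (y : Fin k → Site d) : (toConfig y).degree = k := by
  simp [toConfig, map_sum, Finsupp.degree_single]

theorem exists_toConfig_eq (ξ : Site d →₀ ℕ) : ∃ (k : ℕ) (y : Fin k → Site d), toConfig y = ξ := by
  induction ξ using Finsupp.induction_linear with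
  | zero => exact ⟨0, Fin.elim0, by simp [toConfig]⟩
  | add f g hf hg =>
    obtain ⟨k, y, rfl⟩ := hf
    obtain ⟨l, z, rfl⟩ := hg
    exact ⟨k + l, Fin.append y z, by simp [toConfig, Fin.sum_univ_add]⟩
  | single a n =>
    exact ⟨n, fun _ => a, by simp [toConfig]⟩

theorem toConfig_prod_pow {R : Type*} [CommMonoid R] {k : ℕ} (y : Fin k → Site d)
    (r : Site d → R) : ((toConfig y).prod fun x n => r x ^ n) = ∏ i, r (y i) := by
  rw [toConfig, ← Finsupp.prod_finsetSum_index (by simp) (fun _ _ _ => pow_add _ _ _)]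
  simp

theorem fallingProd_single_one_add (ξ : Site d →₀ ℕ) (y : Site d) (η : Config d) :
    fallingProd (Finsupp.single y 1 + ξ) η
      = η y * fallingProd ξ (Function.update η y (η y - 1)) := by
  classical
  rw [fallingProd_eq_prod _ (s := insert y ξ.support), fallingProd_eq_prod ξ (s := insert y ξ.support)
    (Finset.subset_insert _ _), ← Finset.mul_prod_erase _ _ (Finset.mem_insert_self y _),
    ← Finset.mul_prod_erase _ (fun x => (Function.update η y (η y - 1) x).descFactorial (ξ x))
      (Finset.mem_insert_self y _), ← mul_assoc]
  · congr 1
    · simp only [Finsupp.add_apply, Finsupp.single_eq_same, Function.update_self, add_comm 1]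
      cases h : η y with
      | zero => simp
      | succ n => rw [Nat.succ_descFactorial_succ]; simp
    · refine Finset.prod_congr rfl fun x hx => ?_
      have hx' : x ≠ y := Finset.ne_of_mem_erase hx
      simp [hx']
  · refine Finsupp.support_add.trans (Finset.union_subset ?_ (Finset.subset_insert _ _))
    exact Finsupp.support_single_subset.trans (by simp)

theorem tsum_fin_succ {k : ℕ} {β : Type*} (f : (Fin (k + 1) → β) → ℝ≥0∞) :
    ∑' a, f a = ∑' (b : β), ∑' c : Fin k → β, f (Fin.cons b c) := by
  rw [← ENNReal.tsum_prod (f := fun (b : β) (c : Fin k → β) => f (Fin.cons b c)),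
    ← (Fin.consEquiv fun _ : Fin (k + 1) => β).tsum_eq]
  rfl

theorem prod_tsum {k : ℕ} {β : Type*} (f : Fin k → β → ℝ≥0∞) :
    ∏ i, ∑' b, f i b = ∑' x : Fin k → β, ∏ i, f i (x i) := by
  induction k with
  | zero => simp
  | succ k ih =>
    rw [tsum_fin_succ, Fin.prod_univ_succ, ih, ← ENNReal.tsum_mul_right]
    refine tsum_congr fun b => ?_
    rw [← ENNReal.tsum_mul_left]
    refine tsum_congr fun c => ?_
    simp [Fin.prod_univ_succ]

open Classical in
/-- The number of injective tuples of elements of `A` at the prescribed positions `y`. -/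
def tupleCount {α : Type*} {k : ℕ} (A : Set α) (w : α → Site d) (y : Fin k → Site d) : ℝ≥0∞ :=
  ∑' a : Fin k → α, if Function.Injective a ∧ ∀ i, a i ∈ A ∧ w (a i) = y i then 1 else 0

/-- Choose the first particle among those at the first site, remove it from `A`, and count the rest.
Finiteness of the fibres is essential, since `Set.ncard` of an infinite set is zero. -/
theorem tupleCount_eq_fallingProd {α : Type*} {k : ℕ} (A : Set α) (w : α → Site d)
    (y : Fin k → Site d) (hfin : ∀ i, {a | a ∈ A ∧ w a = y i}.Finite) :
    tupleCount A w y = fallingProd (toConfig y) fun x => Set.ncard {a | a ∈ A ∧ w a = x} := by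
  classical
  induction k generalizing A with
  | zero => simp [tupleCount, toConfig, fallingProd, Function.injective_of_subsingleton]
  | succ k ih =>
    obtain ⟨z, ys, rfl⟩ : ∃ z ys, y = Fin.cons z ys := ⟨y 0, Fin.tail y, by simp⟩
    have hz : {a | a ∈ A ∧ w a = z}.Finite := by simpa using hfin 0
    have hys : ∀ i, {a | a ∈ A ∧ w a = ys i}.Finite := fun i => by simpa using hfin i.succ
    rw [tupleCount, tsum_fin_succ, toConfig_cons, fallingProd_single_one_add]
    have h1 : ∀ b : α, (∑' c : Fin k → α,
        if Function.Injective (Fin.cons b c : Fin (k + 1) → α) ∧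
          ∀ i, (Fin.cons b c : Fin (k + 1) → α) i ∈ A ∧
            w ((Fin.cons b c : Fin (k + 1) → α) i) = (Fin.cons z ys : Fin (k + 1) → Site d) i
          then (1 : ℝ≥0∞) else 0)
        = ({a | a ∈ A ∧ w a = z} : Set α).indicator (fun _ => ((fallingProd (toConfig ys)
          (Function.update (fun x => Set.ncard {a | a ∈ A ∧ w a = x}) z
            (Set.ncard {a | a ∈ A ∧ w a = z} - 1)) : ℕ) : ℝ≥0∞)) b := by
      intro b
      by_cases hb : b ∈ ({a | a ∈ A ∧ w a = z} : Set α)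
      · rw [Set.indicator_of_mem hb]
        have h2 : (fun x => Set.ncard {a | a ∈ A \ {b} ∧ w a = x})
            = Function.update (fun x => Set.ncard {a | a ∈ A ∧ w a = x}) z
            (Set.ncard {a | a ∈ A ∧ w a = z} - 1) := by
          ext x
          by_cases hx : x = z
          · subst hx
            rw [Function.update_self, ← Set.ncard_sdiff_singleton_of_mem hb]
            congr 1
            ext a
            simp only [Set.mem_ofPred_eq, Set.mem_sdiff, Set.mem_singleton_iff]
            tauto
          · rw [Function.update_of_ne hx]
            congr 1
            ext a
            simp only [Set.mem_ofPred_eq, Set.mem_sdiff, Set.mem_singleton_iff]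
            constructor
            · rintro ⟨⟨h, -⟩, h'⟩
              exact ⟨h, h'⟩
            · rintro ⟨h, h'⟩
              refine ⟨⟨h, ?_⟩, h'⟩
              rintro rfl
              exact hx (h'.symm.trans hb.2)
        rw [← h2, ← ih (A \ {b}) ys fun i => (hys i).subset fun a ha => ⟨ha.1.1, ha.2⟩, tupleCount]
        refine tsum_congr fun c => ?_
        congr 1
        rw [Fin.cons_injective_iff, Fin.forall_fin_succ]
        simp only [Fin.cons_zero, Fin.cons_succ, Set.mem_sdiff, Set.mem_singleton_iff,
          Set.mem_range, eq_iff_iff, not_exists]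
        constructor
        · rintro ⟨⟨h3, h4⟩, -, h5⟩
          exact ⟨h4, fun i => ⟨⟨(h5 i).1, h3 i⟩, (h5 i).2⟩⟩
        · rintro ⟨h4, h5⟩
          exact ⟨⟨fun i => (h5 i).1.2, h4⟩, hb, fun i => ⟨(h5 i).1.1, (h5 i).2⟩⟩
      · rw [Set.indicator_of_notMem hb, ENNReal.tsum_eq_zero]
        intro c
        rw [if_neg]
        rintro ⟨-, h⟩
        exact hb (by simpa using h 0)
    simp_rw [h1]
    rw [← tsum_subtype, ENNReal.tsum_set_const, ← hz.cast_ncard_eq]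
    push_cast
    rfl

theorem finite_fiber_of_tupleCount_ne_top {α : Type*} (A : Set α) (w : α → Site d) (z : Site d)
    (h : tupleCount A w (fun _ : Fin 1 => z) ≠ ⊤) : {a | a ∈ A ∧ w a = z}.Finite := by
  classical
  have h1 := ENNReal.finite_const_le_of_tsum_ne_top h one_ne_zero
  refine (h1.image fun a => a 0).subset ?_
  intro b hb
  refine ⟨fun _ => b, ?_, rfl⟩
  simp only [Set.mem_ofPred_eq]
  rw [if_pos ⟨Function.injective_of_subsingleton _, fun _ => hb⟩]

/-! ### Independent walkers and duality -/

variable {p : Site d → PMF (Site d)}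

/-- Joint law of the positions at time `t` of independent walkers, one for each label `(x, i)`,
started from `x`. -/
def walkersLaw (p : Site d → PMF (Site d)) (t : ℝ≥0) : Measure (Site d × ℕ → Site d) :=
  Measure.infinitePi fun a : Site d × ℕ => walkLaw p t a.1

instance (t : ℝ≥0) : IsProbabilityMeasure (walkersLaw p t) := by
  unfold walkersLaw; infer_instance

theorem measurableSet_walkers {k : ℕ} (a : Fin k → Site d × ℕ) (y : Fin k → Site d) :
    MeasurableSet {w : Site d × ℕ → Site d | ∀ i, w (a i) = y i} := by
  have : {w : Site d × ℕ → Site d | ∀ i, w (a i) = y i}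
      = ⋂ i, (fun w : Site d × ℕ → Site d => w (a i)) ⁻¹' {y i} := by
    ext; simp
  rw [this]
  exact MeasurableSet.iInter fun i => measurable_pi_apply _ (measurableSet_singleton _)

theorem walkersLaw_apply {k : ℕ} (t : ℝ≥0) {a : Fin k → Site d × ℕ} (ha : Function.Injective a)
    (y : Fin k → Site d) :
    walkersLaw p t {w | ∀ i, w (a i) = y i} = ∏ i, walkLaw p t (a i).1 {y i} := by
  classical
  have h := Measure.infinitePi_pi (fun a : Site d × ℕ => walkLaw p t a.1)
    (s := Finset.univ.map ⟨a, ha⟩) (t := fun b => {Function.extend a y 0 b})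
    fun _ _ => measurableSet_singleton _
  rw [Finset.prod_map] at h
  simp only [Function.Embedding.coeFn_mk, ha.extend_apply] at h
  rw [walkersLaw, ← h]
  congr 1
  ext w
  simp [Set.mem_pi, ha.extend_apply]

/-- Distinct labels move independently, so an injective tuple reaches `y` with a product probability
that depends only on its starting sites; the tuples are then grouped by those sites. -/
theorem lintegral_tupleCount_walkersLaw {k : ℕ} (t : ℝ≥0) (A : Set (Site d × ℕ))
    (y : Fin k → Site d) :
    ∫⁻ w, tupleCount A w y ∂(walkersLaw p t)
      = ∑' x : Fin k → Site d, (∏ i, walkLaw p t (x i) {y i}) * tupleCount A Prod.fst x := by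
  classical
  simp_rw [tupleCount, ← ENNReal.tsum_mul_left]
  rw [lintegral_tsum, ENNReal.tsum_comm]
  · refine tsum_congr fun a => ?_
    rw [tsum_eq_single (fun i => (a i).1)]
    · by_cases h : Function.Injective a ∧ ∀ i, a i ∈ A
      · rw [if_pos ⟨h.1, fun i => ⟨h.2 i, rfl⟩⟩, mul_one, ← walkersLaw_apply t h.1,
          ← lintegral_indicator_one (measurableSet_walkers a y)]
        refine lintegral_congr fun w => ?_
        simp [Set.indicator_apply, h.1, h.2]
      · rw [if_neg fun h' => h ⟨h'.1, fun i => (h'.2 i).1⟩, mul_zero]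
        have : ∀ w : Site d × ℕ → Site d,
            ¬ (Function.Injective a ∧ ∀ i, a i ∈ A ∧ w (a i) = y i) :=
          fun w h' => h ⟨h'.1, fun i => (h'.2 i).1⟩
        simp [this]
    · intro x hx
      rw [if_neg, mul_zero]
      rintro ⟨-, h⟩
      exact hx (funext fun i => (h i).2.symm)
  · intro a
    refine Measurable.aemeasurable ?_
    by_cases h : Function.Injective a ∧ ∀ i, a i ∈ A
    · simp only [h.1, h.2, true_and]
      exact Measurable.ite (measurableSet_walkers a y) measurable_const measurable_const
    · have : ∀ w : Site d × ℕ → Site d,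
            ¬ (Function.Injective a ∧ ∀ i, a i ∈ A ∧ w (a i) = y i) :=
          fun w h' => h ⟨h'.1, fun i => (h'.2 i).1⟩
      simp [this]

/-- The labels of the particles of a configuration. -/
def labels (η : Config d) : Set (Site d × ℕ) := {a | a.2 < η a.1}

theorem labels_fiber (η : Config d) (x : Site d) :
    {a | a ∈ labels η ∧ a.1 = x} = Prod.mk x '' (Finset.range (η x) : Set ℕ) := by
  ext ⟨b, i⟩
  simp only [labels, Set.mem_ofPred_eq, Set.mem_image, Finset.coe_range, Set.mem_Iio, Prod.mk.injEq]
  constructor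
  · rintro ⟨h, rfl⟩
    exact ⟨i, h, rfl, rfl⟩
  · rintro ⟨j, hj, rfl, rfl⟩
    exact ⟨hj, rfl⟩

theorem tupleCount_labels_fst {k : ℕ} (η : Config d) (x : Fin k → Site d) :
    tupleCount (labels η) Prod.fst x = fallingProd (toConfig x) η := by
  rw [tupleCount_eq_fallingProd]
  · congr 2
    ext z
    rw [labels_fiber, Set.ncard_image_of_injective _ (Prod.mk_right_injective z)]
    simp
  · intro i
    rw [labels_fiber]
    exact (Finset.finite_toSet _).image _

theorem tupleCount_labels {k : ℕ} (η : Config d) (w : Site d × ℕ → Site d) (y : Fin k → Site d)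
    (hfin : ∀ i, {a | a ∈ labels η ∧ w a = y i}.Finite) :
    tupleCount (labels η) w y = fallingProd (toConfig y) (countAt η w) :=
  tupleCount_eq_fallingProd _ _ _ hfin

theorem measurableSet_label (a : Site d × ℕ) :
    MeasurableSet {q : Config d × (Site d × ℕ → Site d) | a.2 < q.1 a.1} :=
  ((measurable_pi_apply a.1).comp measurable_fst) (MeasurableSet.of_discrete (s := {n | a.2 < n}))

theorem measurableSet_label_position (a : Site d × ℕ) (y : Site d) :
    MeasurableSet {q : Config d × (Site d × ℕ → Site d) | q.2 a = y} :=
  measurableSet_eq_fun ((measurable_pi_apply a).comp measurable_snd) measurable_const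

theorem measurable_countAt :
    Measurable fun q : Config d × (Site d × ℕ → Site d) => countAt q.1 q.2 := by
  refine measurable_pi_lambda _ fun y => ?_
  refine measurable_ncard.comp (measurable_set_iff.mpr fun a => ?_)
  exact measurableSet_setOfPred.mp ((measurableSet_label a).inter (measurableSet_label_position a y))

theorem measurable_tupleCount_labels {k : ℕ} (y : Fin k → Site d) :
    Measurable fun q : Config d × (Site d × ℕ → Site d) => tupleCount (labels q.1) q.2 y := by
  classical
  unfold tupleCount
  refine Measurable.tsum fun a => ?_
  refine Measurable.ite ?_ measurable_const measurable_const
  by_cases h : Function.Injective a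
  · simp only [h, true_and, Set.ofPred_forall]
    exact MeasurableSet.iInter fun i =>
      (measurableSet_label (a i)).inter (measurableSet_label_position (a i) (y i))
  · simp [h]

/-- The expected number of particles arriving at `y` is `r' y`, which is finite. This excludes the
default value of `countAt` at sites with infinitely many particles. -/
theorem HasPoissonMoments.ae_finite_fiber {μ : Measure (Config d)} {r r' : Site d → ℝ≥0}
    [SFinite μ] (hμ : HasPoissonMoments μ r) (t : ℝ≥0)
    (hr : ∀ y, ∑' x, walkLaw p t x {y} * (r x : ℝ≥0∞) = r' y) :
    ∀ᵐ q ∂(μ.prod (walkersLaw p t)), ∀ y, {a | a ∈ labels q.1 ∧ q.2 a = y}.Finite := by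
  rw [ae_all_iff]
  intro y
  have hm := measurable_tupleCount_labels (d := d) (fun _ : Fin 1 => y)
  have h : ∫⁻ q, tupleCount (labels q.1) q.2 (fun _ : Fin 1 => y) ∂(μ.prod (walkersLaw p t))
      = r' y := by
    rw [lintegral_prod _ hm.aemeasurable]
    simp_rw [lintegral_tupleCount_walkersLaw, tupleCount_labels_fst]
    rw [lintegral_tsum fun x => by
      exact ((measurable_fallingProd_ennreal _).const_mul _).aemeasurable]
    rw [← hr y]
    have h2 : ∀ x : Fin 1 → Site d, ∫⁻ η, (∏ i, walkLaw p t (x i) {y}) *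
        (fallingProd (toConfig x) η : ℝ≥0∞) ∂μ = ∏ i, walkLaw p t (x i) {y} * (r (x i) : ℝ≥0∞) := by
      intro x
      rw [lintegral_const_mul' _ _ (ENNReal.prod_ne_top fun i _ => measure_ne_top _ _), hμ,
        toConfig_prod_pow, Finset.prod_mul_distrib]
    simp_rw [h2]
    rw [← prod_tsum fun (_ : Fin 1) x => walkLaw p t x {y} * (r x : ℝ≥0∞)]
    simp
  filter_upwards [ae_lt_top hm (by rw [h]; exact ENNReal.coe_ne_top)] with q hq
  exact finite_fiber_of_tupleCount_ne_top _ _ _ hq.ne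

/-- Duality of the system of independent random walkers with respect to falling factorials. -/
theorem HasPoissonMoments.lintegral_mul_fallingProd {μ : Measure (Config d)} {r r' : Site d → ℝ≥0}
    [SFinite μ] (hμ : HasPoissonMoments μ r) (t : ℝ≥0)
    (hr : ∀ y, ∑' x, walkLaw p t x {y} * (r x : ℝ≥0∞) = r' y)
    {f : Config d → ℝ≥0∞} (hf : Measurable f) {k : ℕ} (y : Fin k → Site d) :
    ∫⁻ q, f q.1 * (fallingProd (toConfig y) (countAt q.1 q.2) : ℝ≥0∞) ∂(μ.prod (walkersLaw p t))
      = ∑' x : Fin k → Site d, (∏ i, walkLaw p t (x i) {y i}) *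
          ∫⁻ η, f η * (fallingProd (toConfig x) η : ℝ≥0∞) ∂μ := by
  have h1 : ∫⁻ q, f q.1 * (fallingProd (toConfig y) (countAt q.1 q.2) : ℝ≥0∞)
        ∂(μ.prod (walkersLaw p t))
      = ∫⁻ q, f q.1 * tupleCount (labels q.1) q.2 y ∂(μ.prod (walkersLaw p t)) := by
    refine lintegral_congr_ae ?_
    filter_upwards [hμ.ae_finite_fiber t hr] with q hq
    rw [tupleCount_labels _ _ _ fun i => hq (y i)]
  have hm : ∀ x : Fin k → Site d, Measurable fun η : Config d =>
      f η * (fallingProd (toConfig x) η : ℝ≥0∞) := fun x =>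
    hf.mul (measurable_fallingProd_ennreal _)
  have hm' : Measurable fun q : Config d × (Site d × ℕ → Site d) =>
      f q.1 * tupleCount (labels q.1) q.2 y :=
    (hf.comp measurable_fst).mul (measurable_tupleCount_labels y)
  rw [h1, lintegral_prod _ hm'.aemeasurable]
  have h2 : ∀ η, ∫⁻ w, f η * tupleCount (labels η) w y ∂(walkersLaw p t)
      = ∑' x : Fin k → Site d, (∏ i, walkLaw p t (x i) {y i}) *
          (f η * (fallingProd (toConfig x) η : ℝ≥0∞)) := by
    intro η
    have hmη : Measurable fun w : Site d × ℕ → Site d => tupleCount (labels η) w y :=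
      (measurable_tupleCount_labels y).comp measurable_prodMk_left
    rw [lintegral_const_mul _ hmη, lintegral_tupleCount_walkersLaw, ← ENNReal.tsum_mul_left]
    refine tsum_congr fun x => ?_
    rw [tupleCount_labels_fst]
    ring
  simp_rw [h2]
  rw [lintegral_tsum fun x => ((hm x).const_mul _).aemeasurable]
  refine tsum_congr fun x => ?_
  rw [lintegral_const_mul _ (hm x)]

/-- Duality with the constant function `1`: the sum over starting tuples factors over coordinates,
each giving the transported density. -/
theorem HasPoissonMoments.map_countAt {μ : Measure (Config d)} {r r' : Site d → ℝ≥0}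
    [SFinite μ] (hμ : HasPoissonMoments μ r) (t : ℝ≥0)
    (hr : ∀ y, ∑' x, walkLaw p t x {y} * (r x : ℝ≥0∞) = r' y) :
    HasPoissonMoments ((μ.prod (walkersLaw p t)).map fun q => countAt q.1 q.2) r' := by
  intro ξ
  obtain ⟨k, y, rfl⟩ := exists_toConfig_eq ξ
  rw [lintegral_map (measurable_fallingProd_ennreal _) measurable_countAt]
  have h := hμ.lintegral_mul_fallingProd t hr (measurable_const (a := (1 : ℝ≥0∞))) y
  simp only [one_mul] at h
  rw [h]
  have h2 : ∀ x : Fin k → Site d, (∏ i, walkLaw p t (x i) {y i}) *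
      ∫⁻ η, (fallingProd (toConfig x) η : ℝ≥0∞) ∂μ
      = ∏ i, walkLaw p t (x i) {y i} * (r (x i) : ℝ≥0∞) := by
    intro x
    rw [hμ, toConfig_prod_pow, Finset.prod_mul_distrib]
  simp_rw [h2]
  rw [← prod_tsum fun i x => walkLaw p t x {y i} * (r x : ℝ≥0∞), toConfig_prod_pow]
  simp_rw [hr]

end BoltzmannGibbs

end

noncomputable section

namespace BoltzmannGibbs

open scoped Nat

variable {d : ℕ} {p : Site d → PMF (Site d)}

/-! ### Two-time covariances -/

/-- Duality is an identity in `ℝ≥0∞`; splitting `f` into positive and negative parts transfers it to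
signed functions. -/
theorem integral_mul_natCast_eq {α : Type*} [MeasurableSpace α] {μ : Measure α} {f : α → ℝ}
    {g : α → ℕ} (h : Integrable (fun a => f a * g a) μ) :
    ∫ a, f a * g a ∂μ = (∫⁻ a, ENNReal.ofReal (f a) * g a ∂μ).toReal
        - (∫⁻ a, ENNReal.ofReal (-f a) * g a ∂μ).toReal ∧
      ∫⁻ a, ENNReal.ofReal (f a) * g a ∂μ ≠ ⊤ ∧ ∫⁻ a, ENNReal.ofReal (-f a) * g a ∂μ ≠ ⊤ := by
  have h1 : ∀ a, ENNReal.ofReal (f a * g a) = ENNReal.ofReal (f a) * g a := fun a => by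
    rw [ENNReal.ofReal_mul' (Nat.cast_nonneg _), ENNReal.ofReal_natCast]
  have h2 : ∀ a, ENNReal.ofReal (-(f a * g a)) = ENNReal.ofReal (-f a) * g a := fun a => by
    rw [← neg_mul, ENNReal.ofReal_mul' (Nat.cast_nonneg _), ENNReal.ofReal_natCast]
  refine ⟨?_, ?_, ?_⟩
  · rw [integral_eq_lintegral_pos_part_sub_lintegral_neg_part h]
    simp_rw [h1, h2]
  · simp_rw [← h1]
    exact h.lintegral_lt_top.ne
  · simp_rw [← h2]
    exact h.neg.lintegral_lt_top.ne

section Covariance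

variable {μ : Measure (Config d)} [IsProbabilityMeasure μ] {r r' : Site d → ℝ≥0}

theorem HasPoissonMoments.integrable_mul_fallingProd_countAt (hμ : HasPoissonMoments μ r) (t : ℝ≥0)
    (hr : ∀ y, ∑' x, walkLaw p t x {y} * (r x : ℝ≥0∞) = r' y)
    {f : Config d → ℝ} (hf : MemLp f 2 μ)
    (ξ : Site d →₀ ℕ) :
    Integrable (fun q => f q.1 * (fallingProd ξ (countAt q.1 q.2) : ℝ))
      (μ.prod (walkersLaw p t)) := by
  have h1 : MemLp (fun q : Config d × (Site d × ℕ → Site d) => f q.1) 2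
      (μ.prod (walkersLaw p t)) := hf.comp_fst _
  have h2 : MemLp (fun q : Config d × (Site d × ℕ → Site d) =>
      (fallingProd ξ (countAt q.1 q.2) : ℝ)) 2 (μ.prod (walkersLaw p t)) :=
    (memLp_map_measure_iff (measurable_fallingProd_real ξ).aestronglyMeasurable
      measurable_countAt.aemeasurable).mp ((hμ.map_countAt t hr).memLp_fallingProd ξ)
  exact h1.integrable_mul h2

theorem HasPoissonMoments.integral_mul_fallingProd_countAt (hμ : HasPoissonMoments μ r) (t : ℝ≥0)
    (hr : ∀ y, ∑' x, walkLaw p t x {y} * (r x : ℝ≥0∞) = r' y)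
    {f : Config d → ℝ} (hfm : Measurable f)
    (hf : MemLp f 2 μ) {k : ℕ} (y : Fin k → Site d) :
    ∫ q, f q.1 * (fallingProd (toConfig y) (countAt q.1 q.2) : ℝ) ∂(μ.prod (walkersLaw p t))
      = ∑' x : Fin k → Site d, (∏ i, walkLaw p t (x i) {y i}).toReal *
          ∫ η, f η * (fallingProd (toConfig x) η : ℝ) ∂μ := by
  obtain ⟨h1, h2, h3⟩ :=
    integral_mul_natCast_eq (hμ.integrable_mul_fallingProd_countAt t hr hf (toConfig y))
  rw [hμ.lintegral_mul_fallingProd t hr (f := fun η => ENNReal.ofReal (f η)) (by fun_prop)] at h1 h2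
  rw [hμ.lintegral_mul_fallingProd t hr (f := fun η => ENNReal.ofReal (-f η)) (by fun_prop)] at h1 h3
  rw [h1, ENNReal.tsum_toReal_eq (ENNReal.ne_top_of_tsum_ne_top h2),
    ENNReal.tsum_toReal_eq (ENNReal.ne_top_of_tsum_ne_top h3),
    ← (ENNReal.summable_toReal h2).tsum_sub (ENNReal.summable_toReal h3)]
  refine tsum_congr fun x => ?_
  rw [ENNReal.toReal_mul, ENNReal.toReal_mul, ← mul_sub]
  congr 1
  have h4 : Integrable (fun η => f η * (fallingProd (toConfig x) η : ℝ)) μ :=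
    hf.integrable_mul (hμ.memLp_fallingProd _)
  exact (integral_mul_natCast_eq h4).1.symm

/-- Transition probability, up to time `t`, from an unordered tuple `ξ` of labelled walkers to `y`. -/
def tupleTransition (p : Site d → PMF (Site d)) (t : ℝ≥0) (ξ : Site d →₀ ℕ) {k : ℕ}
    (y : Fin k → Site d) : ℝ≥0∞ :=
  ∑' x : Fin k → Site d, ({x | toConfig x = ξ} : Set (Fin k → Site d)).indicator
    (fun x => ∏ i, walkLaw p t (x i) {y i}) x

theorem measurable_tupleTransition (ξ : Site d →₀ ℕ) {k : ℕ} (y : Fin k → Site d) :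
    Measurable fun t => tupleTransition p t ξ y := by
  classical
  unfold tupleTransition
  refine Measurable.tsum fun x => ?_
  simp only [Set.indicator_apply]
  split_ifs
  · exact Finset.measurable_fun_prod _ fun i _ => measurable_walkLaw_singleton _ _
  · exact measurable_const

theorem tupleTransition_le_one (t : ℝ≥0) (ξ : Site d →₀ ℕ) {k : ℕ} (y : Fin k → Site d)
    (hp : IsAdmissible p) : tupleTransition p t ξ y ≤ 1 := by
  calc tupleTransition p t ξ y ≤ ∑' x : Fin k → Site d, ∏ i, walkLaw p t (x i) {y i} :=
        ENNReal.tsum_le_tsum fun x => Set.indicator_le_self _ _ x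
    _ = ∏ i, ∑' x, walkLaw p t x {y i} := (prod_tsum fun i x => walkLaw p t x {y i}).symm
    _ = 1 := by simp_rw [hp.walkLaw_comm t _ (y _), tsum_walkLaw_singleton, Finset.prod_const_one]

/-- Duality reduces to pairings at the initial time between objects of degrees `k ≤ ξ.degree`, and
orthogonality keeps only the tuples that are orderings of `ξ`. -/
theorem HasPoissonMoments.integral_orthoPoly_mul_fallingProd_countAt (hμ : HasPoissonMoments μ r) (t : ℝ≥0)
    (hr : ∀ y, ∑' x, walkLaw p t x {y} * (r x : ℝ≥0∞) = r' y)
    (hp : IsAdmissible p)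
    (ξ : Site d →₀ ℕ) {k : ℕ} (y : Fin k → Site d) (hk : k ≤ ξ.degree) :
    ∫ q, orthoPoly (fun x => (r x : ℝ)) ξ q.1 * (fallingProd (toConfig y) (countAt q.1 q.2) : ℝ)
        ∂(μ.prod (walkersLaw p t))
      = orthoNorm r ξ * (tupleTransition p t ξ y).toReal := by
  classical
  rw [hμ.integral_mul_fallingProd_countAt t hr (measurable_orthoPoly _ _) (hμ.memLp_orthoPoly ξ)]
  have hfin : tupleTransition p t ξ y ≠ ⊤ :=
    ((tupleTransition_le_one t ξ y hp).trans_lt ENNReal.one_lt_top).ne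
  rw [tupleTransition, ENNReal.tsum_toReal_eq (ENNReal.ne_top_of_tsum_ne_top hfin), ← tsum_mul_left]
  refine tsum_congr fun x => ?_
  rw [hμ.integral_orthoPoly_mul_fallingProd ξ (toConfig x) (by rwa [degree_toConfig])]
  by_cases h : toConfig x = ξ
  · rw [if_pos h, Set.indicator_of_mem (by exact h), mul_comm]
  · rw [if_neg h, Set.indicator_of_notMem (by exact h)]
    simp

/-- Duality conserves the number of particles, so a later function of lower degree is seen at the
initial time as one of lower degree, orthogonal to the polynomial of `ξ`. -/
theorem HasPoissonMoments.integral_orthoPoly_mul_fallingSpan (hμ : HasPoissonMoments μ r) (t : ℝ≥0)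
    (hr : ∀ y, ∑' x, walkLaw p t x {y} * (r x : ℝ≥0∞) = r' y)
    (hp : IsAdmissible p)
    (ξ : Site d →₀ ℕ) {h : Config d → ℝ} (hh : h ∈ fallingSpan d ξ.degree) :
    Integrable (fun q => orthoPoly (fun x => (r x : ℝ)) ξ q.1 * h (countAt q.1 q.2))
        (μ.prod (walkersLaw p t)) ∧
      ∫ q, orthoPoly (fun x => (r x : ℝ)) ξ q.1 * h (countAt q.1 q.2)
        ∂(μ.prod (walkersLaw p t)) = 0 := by
  induction hh using Submodule.span_induction with
  | mem h hh =>
    obtain ⟨ξ', hξ', rfl⟩ := hh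
    refine ⟨hμ.integrable_mul_fallingProd_countAt t hr (hμ.memLp_orthoPoly ξ) ξ', ?_⟩
    obtain ⟨l, y, rfl⟩ := exists_toConfig_eq ξ'
    rw [degree_toConfig] at hξ'
    rw [hμ.integral_orthoPoly_mul_fallingProd_countAt t hr hp ξ y hξ'.le]
    have : tupleTransition p t ξ y = 0 := by
      rw [tupleTransition, ENNReal.tsum_eq_zero]
      intro x
      refine Set.indicator_of_notMem (fun hx => ?_) _
      have hx' : toConfig x = ξ := hx
      rw [← hx', degree_toConfig] at hξ'
      exact lt_irrefl _ hξ'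
    simp [this]
  | zero => simp
  | add h h' _ _ ih ih' =>
    simp only [Pi.add_apply, mul_add]
    refine ⟨ih.1.add ih'.1, ?_⟩
    rw [integral_add ih.1 ih'.1, ih.2, ih'.2, add_zero]
  | smul c h _ ih =>
    simp only [Pi.smul_apply, smul_eq_mul, mul_left_comm _ c]
    refine ⟨ih.1.const_mul c, ?_⟩
    rw [integral_const_mul, ih.2, mul_zero]

/-- The centering `c` of the later polynomial is arbitrary: it affects only terms of lower degree,
which do not contribute. -/
theorem HasPoissonMoments.integral_orthoPoly_mul_orthoPoly (hμ : HasPoissonMoments μ r) (t : ℝ≥0)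
    (hr : ∀ y, ∑' x, walkLaw p t x {y} * (r x : ℝ≥0∞) = r' y)
    (hp : IsAdmissible p)
    (ξ : Site d →₀ ℕ) {k : ℕ} (y : Fin k → Site d) (hk : ξ.degree = k) (c : Site d → ℝ) :
    ∫ q, orthoPoly (fun x => (r x : ℝ)) ξ q.1 * orthoPoly c (toConfig y) (countAt q.1 q.2)
        ∂(μ.prod (walkersLaw p t))
      = orthoNorm r ξ * (tupleTransition p t ξ y).toReal := by
  have h1 := orthoPoly_sub_fallingProd_mem_fallingSpan c (toConfig y)
  replace h1 := fallingSpan_mono (n := ξ.degree) (by rw [degree_toConfig, hk]) h1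
  have h2 := hμ.integral_orthoPoly_mul_fallingSpan t hr hp ξ h1
  have h3 := hμ.integrable_mul_fallingProd_countAt t hr (hμ.memLp_orthoPoly ξ) (toConfig y)
  have h4 : ∀ q : Config d × (Site d × ℕ → Site d),
      orthoPoly (fun x => (r x : ℝ)) ξ q.1 * orthoPoly c (toConfig y) (countAt q.1 q.2)
      = orthoPoly (fun x => (r x : ℝ)) ξ q.1 * (orthoPoly c (toConfig y) (countAt q.1 q.2) -
          (fallingProd (toConfig y) (countAt q.1 q.2) : ℝ)) +
        orthoPoly (fun x => (r x : ℝ)) ξ q.1 * (fallingProd (toConfig y) (countAt q.1 q.2) : ℝ) :=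
    fun q => by ring
  simp_rw [h4]
  rw [integral_add h2.1 h3, h2.2, zero_add,
    hμ.integral_orthoPoly_mul_fallingProd_countAt t hr hp ξ y hk.ge]

end Covariance

/-! ### The laws of the process -/

theorem irwTransition_apply (t : ℝ≥0) (η : Config d) {A : Set (Config d)} (hA : MeasurableSet A) :
    irwTransition p t η A = walkersLaw p t {w | countAt η w ∈ A} := by
  have : Measurable (countAt η : (Site d × ℕ → Site d) → Config d) :=
    measurable_countAt.comp measurable_prodMk_left
  rw [irwTransition, Measure.map_apply this hA]
  rfl

section Walkers

variable {Ω : Type*} {mΩ : MeasurableSpace Ω} {P : Measure Ω} [IsProbabilityMeasure P]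
  {μ : Measure (Config d)} {η : ℝ≥0 → Ω → Config d}

/-- Compare both measures on rectangles `B ×ˢ A`, integrating the Markov property over the past
event `η s ∈ B`. Only two-time laws are needed afterwards. -/
theorem IsIRW.map_pair (h : IsIRW p μ P η) {s t : ℝ≥0} (hst : s ≤ t) :
    P.map (fun ω => (η s ω, η t ω))
      = ((P.map (η s)).prod (walkersLaw p (t - s))).map fun q => (q.1, countAt q.1 q.2) := by
  have hms := h.measurable s
  have hmt := h.measurable t
  have : IsProbabilityMeasure (P.map (η s)) := Measure.isProbabilityMeasure_map hms.aemeasurable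
  have : IsProbabilityMeasure (P.map fun ω => (η s ω, η t ω)) :=
    Measure.isProbabilityMeasure_map (hms.prodMk hmt).aemeasurable
  refine Measure.ext_prod fun {B A} hB hA => ?_
  rw [Measure.map_apply (hms.prodMk hmt) (hB.prod hA),
    Measure.map_apply (measurable_fst.prodMk measurable_countAt) (hB.prod hA)]
  have hm : MeasurableSet ((fun q : Config d × (Site d × ℕ → Site d) =>
      (q.1, countAt q.1 q.2)) ⁻¹' B ×ˢ A) :=
    (measurable_fst.prodMk measurable_countAt) (hB.prod hA)
  rw [Measure.prod_apply hm]
  have h1 : ∀ ζ : Config d, walkersLaw p (t - s) (Prod.mk ζ ⁻¹'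
      ((fun q : Config d × (Site d × ℕ → Site d) => (q.1, countAt q.1 q.2)) ⁻¹' B ×ˢ A))
      = B.indicator (fun ζ => irwTransition p (t - s) ζ A) ζ := by
    intro ζ
    by_cases hζ : ζ ∈ B
    · rw [Set.indicator_of_mem hζ, irwTransition_apply _ _ hA]
      congr 1
      ext w
      simp [hζ]
    · rw [Set.indicator_of_notMem hζ]
      convert measure_empty (μ := walkersLaw p (t - s))
      ext w
      simp [hζ]
  have hmK : Measurable fun ζ => irwTransition p (t - s) ζ A := by
    simp_rw [irwTransition_apply _ _ hA]
    exact measurable_measure_prodMk_left (measurable_countAt hA)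
  simp_rw [h1]
  rw [lintegral_map (hmK.indicator hB) hms]
  have hmle : (⨆ u : Set.Iic s, MeasurableSpace.comap (η u) inferInstance) ≤ mΩ :=
    iSup_le fun u => (h.measurable u).comap_le
  have hsB : MeasurableSet[⨆ u : Set.Iic s, MeasurableSpace.comap (η u) inferInstance]
      (η s ⁻¹' B) :=
    (le_iSup (fun u : Set.Iic s => MeasurableSpace.comap (η u) inferInstance)
      ⟨s, Set.mem_Iic.mpr le_rfl⟩) _ ⟨B, hB, rfl⟩
  have hint : Integrable ((η t ⁻¹' A).indicator fun _ => (1 : ℝ)) P :=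
    (integrable_const (1 : ℝ)).indicator (hmt hA)
  have h2 := setIntegral_condExp hmle hint hsB
  rw [setIntegral_congr_ae (hms hB) ((h.markov s t hst A hA).mono fun ω hω _ => hω)] at h2
  have hprob : ∀ ζ : Config d, IsProbabilityMeasure (irwTransition p (t - s) ζ) := fun ζ => by
    unfold irwTransition
    exact Measure.isProbabilityMeasure_map
      (measurable_countAt.comp measurable_prodMk_left).aemeasurable
  have h3 : ∫⁻ ω, B.indicator (fun ζ => irwTransition p (t - s) ζ A) (η s ω) ∂P
      = ENNReal.ofReal (∫ ω in η s ⁻¹' B, (irwTransition p (t - s) (η s ω)).real A ∂P) := by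
    rw [ofReal_integral_eq_lintegral_ofReal]
    · rw [← lintegral_indicator (hms hB)]
      refine lintegral_congr fun ω => ?_
      by_cases hω : η s ω ∈ B
      · rw [Set.indicator_of_mem hω, Set.indicator_of_mem (by exact hω), measureReal_def,
          ENNReal.ofReal_toReal (measure_ne_top _ _)]
      · rw [Set.indicator_of_notMem hω, Set.indicator_of_notMem (by exact hω)]
    · refine Integrable.of_bound (C := 1)
        (hmK.comp hms).ennreal_toReal.aestronglyMeasurable (ae_of_all _ fun ω => ?_)
      rw [Real.norm_of_nonneg measureReal_nonneg]
      exact measureReal_le_one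
    · exact ae_of_all _ fun ω => ENNReal.toReal_nonneg
  rw [h3, h2, setIntegral_indicator (hmt hA), setIntegral_const, smul_eq_mul, mul_one,
    measureReal_def, ENNReal.ofReal_toReal (measure_ne_top _ _)]
  rfl

theorem IsIRW.map_eq (h : IsIRW p μ P η) {s t : ℝ≥0} (hst : s ≤ t) :
    P.map (η t) = ((P.map (η s)).prod (walkersLaw p (t - s))).map fun q => countAt q.1 q.2 := by
  have hm : Measurable fun q : Config d × (Site d × ℕ → Site d) => (q.1, countAt q.1 q.2) :=
    measurable_fst.prodMk measurable_countAt
  ext A hA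
  have h1 : P.map (η t) A = P.map (fun ω => (η s ω, η t ω)) (Prod.snd ⁻¹' A) := by
    have hpair := (h.measurable s).prodMk (h.measurable t)
    rw [Measure.map_apply (h.measurable t) hA,
      Measure.map_apply hpair (measurable_snd hA)]
    rfl
  rw [h1, h.map_pair hst, Measure.map_apply hm (measurable_snd hA),
    Measure.map_apply measurable_countAt hA]
  rfl

end Walkers

/-! ### Moments of the local equilibrium -/

/-- Terms with `n < m` vanish, and shifting `n` by `m` turns the rest into `r ^ m` times the total
Poisson mass. -/
theorem lintegral_descFactorial_poissonMeasure (r : ℝ≥0) (m : ℕ) :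
    ∫⁻ n, (n.descFactorial m : ℝ≥0∞) ∂(poissonMeasure r) = (r : ℝ≥0∞) ^ m := by
  rw [lintegral_countable', ← Summable.sum_add_tsum_nat_add' (k := m) ENNReal.summable,
    Finset.sum_eq_zero, zero_add]
  · have h : ∀ n : ℕ, ((n + m).descFactorial m : ℝ≥0∞) * poissonMeasure r {n + m}
        = (r : ℝ≥0∞) ^ m * poissonMeasure r {n} := by
      intro n
      rw [poissonMeasure_singleton, poissonMeasure_singleton, ← ENNReal.ofReal_natCast,
        ← ENNReal.ofReal_coe_nnreal, ← ENNReal.ofReal_pow r.coe_nonneg,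
        ← ENNReal.ofReal_mul (Nat.cast_nonneg _), ← ENNReal.ofReal_mul (by positivity)]
      congr 1
      have h1 := Nat.factorial_mul_descFactorial (Nat.le_add_left m n)
      rw [Nat.add_sub_cancel] at h1
      rw [← h1]
      have h2 : ((n ! : ℕ) : ℝ) ≠ 0 := by positivity
      have h3 : ((n + m).descFactorial m : ℝ) ≠ 0 := by
        rw [Nat.cast_ne_zero, Ne, Nat.descFactorial_eq_zero_iff_lt]
        omega
      push_cast
      field_simp
      ring
    simp_rw [h]
    rw [ENNReal.tsum_mul_left]
    have h2 := lintegral_countable' (μ := poissonMeasure r) fun _ => 1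
    simp only [lintegral_const, measure_univ, one_mul] at h2
    rw [← h2, mul_one]
  · intro n hn
    rw [Nat.descFactorial_eq_zero_iff_lt.mpr (Finset.mem_range.mp hn)]
    simp

theorem hasPoissonMoments_localEquilibrium (ρ : EuclideanSpace ℝ (Fin d) → ℝ≥0) (N : ℕ) :
    HasPoissonMoments (localEquilibrium ρ N) fun x => ρ (macro_point N x) := by
  intro ξ
  have h := lintegral_prod_eq_prod_lintegral_of_indepFun ξ.support _
    (iIndepFun_infinitePi (P := fun x : Site d => poissonMeasure (ρ (macro_point N x)))
      (X := fun x n => (n.descFactorial (ξ x) : ℝ≥0∞)) fun x => measurable_of_countable _)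
    (fun x => (measurable_of_countable fun n : ℕ => (n.descFactorial (ξ x) : ℝ≥0∞)).comp
      (measurable_pi_apply x))
  simp only [fallingProd, Finsupp.prod, Nat.cast_prod]
  rw [localEquilibrium, h]
  refine Finset.prod_congr rfl fun x _ => ?_
  rw [← lintegral_descFactorial_poissonMeasure,
    ← (measurePreserving_eval_infinitePi
      (fun x : Site d => poissonMeasure (ρ (macro_point N x))) x).lintegral_comp
      (measurable_of_countable _)]

end BoltzmannGibbs

end

noncomputable section

namespace BoltzmannGibbs

open scoped Nat

variable {d : ℕ} {p : Site d → PMF (Site d)}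

/-! ### Application to the process started from local equilibrium -/

/-- The density as a nonnegative real number. -/
def meanDensity {d : ℕ} (p : Site d → PMF (Site d)) (ρ : EuclideanSpace ℝ (Fin d) → ℝ≥0) (N : ℕ)
    (t : ℝ≥0) (x : Site d) : ℝ≥0 :=
  (densityE p ρ N t x).toNNReal

theorem density_eq_meanDensity (ρ : EuclideanSpace ℝ (Fin d) → ℝ≥0) (N : ℕ) (t : ℝ≥0) :
    density p ρ N t = fun x => (meanDensity p ρ N t x : ℝ) :=
  funext fun x => density_eq_toReal ρ N t x

section Walkers

variable {ρ : EuclideanSpace ℝ (Fin d) → ℝ≥0} {A : ℝ} {m : ℕ}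

theorem IsAdmissible.densityE_ne_top (hp : IsAdmissible p) (hd : 1 ≤ d)
    (hρ : ∀ u, (ρ u : ℝ) ≤ A * (1 + ‖u‖) ^ m) {N : ℕ} (hN : 1 ≤ N) (t : ℝ≥0) (x : Site d) :
    densityE p ρ N t x ≠ ⊤ := by
  obtain ⟨B, -, hB⟩ := hp.exists_densityE_bound hd hρ t t.coe_nonneg
  refine ((hB N t x hN ?_).trans_lt ENNReal.ofReal_lt_top).ne
  have : (1 : ℝ) ≤ N := by exact_mod_cast hN
  exact le_mul_of_one_le_left t.coe_nonneg (one_le_pow₀ this)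

theorem IsAdmissible.coe_meanDensity (hp : IsAdmissible p) (hd : 1 ≤ d)
    (hρ : ∀ u, (ρ u : ℝ) ≤ A * (1 + ‖u‖) ^ m) {N : ℕ} (hN : 1 ≤ N) (t : ℝ≥0) (x : Site d) :
    (meanDensity p ρ N t x : ℝ≥0∞) = densityE p ρ N t x :=
  ENNReal.coe_toNNReal (hp.densityE_ne_top hd hρ hN t x)

/-- Only finiteness matters: the covariance formula accepts any centering at the later time, so the
transported density need not be identified by a semigroup property. Finiteness follows by applying
the growth bound to the majorant of the density at time `s`. -/
theorem IsAdmissible.exists_tsum_walkLaw_mul_meanDensity (hp : IsAdmissible p) (hd : 1 ≤ d)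
    (hρ : ∀ u, (ρ u : ℝ) ≤ A * (1 + ‖u‖) ^ m) {N : ℕ} (hN : 1 ≤ N) (s t : ℝ≥0) :
    ∃ r' : Site d → ℝ≥0, ∀ y,
      ∑' x, walkLaw p t x {y} * (meanDensity p ρ N s x : ℝ≥0∞) = r' y := by
  obtain ⟨B, hB0, hB⟩ := hp.exists_densityE_bound hd hρ s s.coe_nonneg
  have hs : (s : ℝ) ≤ (N : ℝ) ^ 2 * s := by
    have : (1 : ℝ) ≤ N := by exact_mod_cast hN
    exact le_mul_of_one_le_left s.coe_nonneg (one_le_pow₀ this)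
  set ρ' : EuclideanSpace ℝ (Fin d) → ℝ≥0 := fun u => Real.toNNReal (B * (1 + ‖u‖) ^ m) with hρ'
  have h1 : ∀ u, (ρ' u : ℝ) ≤ B * (1 + ‖u‖) ^ m := fun u => by
    rw [hρ', Real.coe_toNNReal _ (by positivity)]
  refine ⟨fun y => (∑' x, walkLaw p t x {y} * (meanDensity p ρ N s x : ℝ≥0∞)).toNNReal, fun y => ?_⟩
  rw [ENNReal.coe_toNNReal]
  refine ((ENNReal.tsum_le_tsum fun x => ?_).trans_lt
    (hp.densityE_ne_top hd h1 hN t y).lt_top).ne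
  rw [hp.walkLaw_comm t x y, hp.coe_meanDensity hd hρ hN]
  gcongr
  exact hB N s x hN hs

variable {Ω : Type*} {mΩ : MeasurableSpace Ω} {P : Measure Ω} [IsProbabilityMeasure P]
  {N : ℕ} {η : ℝ≥0 → Ω → Config d}

theorem IsIRW.hasPoissonMoments (h : IsIRW p (localEquilibrium ρ N) P η) (hp : IsAdmissible p)
    (hd : 1 ≤ d) (hρ : ∀ u, (ρ u : ℝ) ≤ A * (1 + ‖u‖) ^ m) (hN : 1 ≤ N) (t : ℝ≥0) :
    HasPoissonMoments (P.map (η t)) (meanDensity p ρ N t) := by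
  have : IsProbabilityMeasure (P.map (η 0)) :=
    Measure.isProbabilityMeasure_map (h.measurable 0).aemeasurable
  rw [h.map_eq (show (0 : ℝ≥0) ≤ t from zero_le), tsub_zero]
  refine HasPoissonMoments.map_countAt (r := fun x => ρ (macro_point N x)) ?_ t fun y => ?_
  · rw [h.initial]
    exact hasPoissonMoments_localEquilibrium ρ N
  · rw [hp.coe_meanDensity hd hρ hN, densityE]
    simp_rw [hp.walkLaw_comm t y]

theorem IsIRW.integral_orthoPoly_mul_orthoPoly (h : IsIRW p (localEquilibrium ρ N) P η)
    (hp : IsAdmissible p) (hd : 1 ≤ d) (hρ : ∀ u, (ρ u : ℝ) ≤ A * (1 + ‖u‖) ^ m) (hN : 1 ≤ N)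
    {s t : ℝ≥0} (hst : s ≤ t) {k : ℕ} (x y : Fin k → Site d) :
    ∫ ω, orthoPoly (density p ρ N s) (toConfig x) (η s ω) *
        orthoPoly (density p ρ N t) (toConfig y) (η t ω) ∂P
      = orthoNorm (meanDensity p ρ N s) (toConfig x) *
          (tupleTransition p (t - s) (toConfig x) y).toReal := by
  have : IsProbabilityMeasure (P.map (η s)) :=
    Measure.isProbabilityMeasure_map (h.measurable s).aemeasurable
  obtain ⟨r', hr'⟩ := hp.exists_tsum_walkLaw_mul_meanDensity hd hρ hN s (t - s)
  have h1 := (h.hasPoissonMoments hp hd hρ hN s).integral_orthoPoly_mul_orthoPoly (t - s) hr' hp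
    (toConfig x) y (degree_toConfig x) (density p ρ N t)
  rw [← h1, density_eq_meanDensity ρ N s]
  have hm : Measurable fun q : Config d × Config d =>
      orthoPoly (fun x => (meanDensity p ρ N s x : ℝ)) (toConfig x) q.1 *
        orthoPoly (density p ρ N t) (toConfig y) q.2 :=
    ((measurable_orthoPoly _ _).comp measurable_fst).mul
      ((measurable_orthoPoly _ _).comp measurable_snd)
  have hm1 : Measurable fun q : Config d × (Site d × ℕ → Site d) => (q.1, countAt q.1 q.2) :=
    measurable_fst.prodMk measurable_countAt
  have h2 := integral_map (μ := P) ((h.measurable s).prodMk (h.measurable t)).aemeasurable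
    hm.aestronglyMeasurable
  have h3 := integral_map (μ := (P.map (η s)).prod (walkersLaw p (t - s))) hm1.aemeasurable
    hm.aestronglyMeasurable
  rw [h.map_pair hst, h3] at h2
  exact h2.symm

theorem IsIRW.memLp_orthoPoly (h : IsIRW p (localEquilibrium ρ N) P η)
    (hp : IsAdmissible p) (hd : 1 ≤ d) (hρ : ∀ u, (ρ u : ℝ) ≤ A * (1 + ‖u‖) ^ m) (hN : 1 ≤ N)
    (t : ℝ≥0) (ξ : Site d →₀ ℕ) :
    MemLp (fun ω => orthoPoly (density p ρ N t) ξ (η t ω)) 2 P := by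
  rw [density_eq_meanDensity]
  exact ((h.hasPoissonMoments hp hd hρ hN t).memLp_orthoPoly ξ).comp_of_map
    (h.measurable t).aemeasurable

theorem IsIRW.integral_orthoPoly_sq (h : IsIRW p (localEquilibrium ρ N) P η)
    (hp : IsAdmissible p) (hd : 1 ≤ d) (hρ : ∀ u, (ρ u : ℝ) ≤ A * (1 + ‖u‖) ^ m) (hN : 1 ≤ N)
    (t : ℝ≥0) (ξ : Site d →₀ ℕ) :
    ∫ ω, orthoPoly (density p ρ N t) ξ (η t ω) ^ 2 ∂P = orthoNorm (meanDensity p ρ N t) ξ := by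
  rw [density_eq_meanDensity, ← ((h.hasPoissonMoments hp hd hρ hN t).integral_orthoPoly_sq ξ).2,
    integral_map (h.measurable t).aemeasurable
      ((measurable_orthoPoly _ _).pow_const 2).aestronglyMeasurable]

end Walkers

/-! ### Bounds on the covariances -/

theorem orthoNorm_nonneg (r : Site d → ℝ≥0) (ξ : Site d →₀ ℕ) : 0 ≤ orthoNorm r ξ :=
  Finset.prod_nonneg fun _ _ => by positivity

theorem orthoNorm_toConfig_le (r : Site d → ℝ≥0) {k : ℕ} (x : Fin k → Site d) :
    orthoNorm r (toConfig x) ≤ (k ! : ℕ) * ∏ i, (r (x i) : ℝ) := by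
  rw [orthoNorm, Finsupp.prod_mul, toConfig_prod_pow]
  gcongr
  have h1 := Nat.prod_factorial_dvd_factorial_sum (toConfig x).support (toConfig x)
  rw [← Finsupp.degree_apply, degree_toConfig] at h1
  have h2 := Nat.le_of_dvd (Nat.factorial_pos k) h1
  rw [Finsupp.prod]
  exact_mod_cast h2

/-- A tuple with the same configuration as `x` takes its values among those of `x`, hence is `x ∘ f`
for some `f`. Summing over all maps `f` overcounts, at the price of a constant `k ^ k`. -/
theorem tupleTransition_le_sum (t : ℝ≥0) {k : ℕ} (x y : Fin k → Site d) :
    tupleTransition p t (toConfig x) y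
      ≤ ∑ f : Fin k → Fin k, ∏ i, walkLaw p t (x (f i)) {y i} := by
  classical
  set s : Finset (Fin k → Site d) := Finset.univ.image fun f : Fin k → Fin k => x ∘ f with hs
  have h1 : ∀ w : Fin k → Site d, toConfig w = toConfig x → w ∈ s := by
    intro w hw
    have h2 : ∀ i, ∃ j, x j = w i := by
      intro i
      by_contra hcon
      push Not at hcon
      have h3 := DFunLike.congr_fun hw (w i)
      simp only [toConfig, Finsupp.finsetSum_apply, Finsupp.single_apply] at h3
      rw [Finset.sum_eq_zero (s := Finset.univ) (f := fun j => if x j = w i then 1 else 0)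
        fun j _ => if_neg (hcon j)] at h3
      have h4 := Finset.sum_eq_zero_iff.mp h3 i (Finset.mem_univ i)
      simp at h4
    choose f hf using h2
    exact Finset.mem_image.mpr ⟨f, Finset.mem_univ f, funext hf⟩
  rw [tupleTransition, tsum_eq_sum (s := s)]
  · refine (Finset.sum_le_sum fun w _ => Set.indicator_le_self _ _ w).trans ?_
    exact Finset.sum_image_le_of_nonneg fun _ _ => zero_le
  · intro w hw
    exact Set.indicator_of_notMem (s := {w | toConfig w = toConfig x}) (fun h => hw (h1 w h)) _

/-- Coordinate `0` is kept and its probabilities sum to one over `z`; each of the other `l` costs a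
factor `κ`. This is the source of the power `k - 1` in the rate. -/
theorem tsum_tupleTransition_le (t : ℝ≥0) {l : ℕ}
    (x y : Fin (l + 1) → Site d) {κ : ℝ≥0∞} (hκ : ∀ w z, walkLaw p t w {z} ≤ κ) :
    ∑' z : Site d, tupleTransition p t (toConfig x) (fun i => z + y i)
      ≤ ((l + 1) ^ (l + 1) : ℕ) * κ ^ l := by
  calc ∑' z : Site d, tupleTransition p t (toConfig x) (fun i => z + y i)
      ≤ ∑' z : Site d, ∑ f : Fin (l + 1) → Fin (l + 1),
          walkLaw p t (x (f 0)) {z + y 0} * κ ^ l := by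
        refine ENNReal.tsum_le_tsum fun z => (tupleTransition_le_sum t x _).trans ?_
        refine Finset.sum_le_sum fun f _ => ?_
        rw [Fin.prod_univ_succ]
        gcongr
        refine (Finset.prod_le_pow_card _ _ κ fun i _ => hκ _ _).trans ?_
        simp
    _ = ∑ _f : Fin (l + 1) → Fin (l + 1), κ ^ l := by
        rw [Summable.tsum_finsetSum fun _ _ => ENNReal.summable]
        refine Finset.sum_congr rfl fun f _ => ?_
        have h := (Equiv.addRight (y 0)).tsum_eq fun z => walkLaw p t (x (f 0)) {z}
        simp only [Equiv.coe_addRight] at h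
        rw [ENNReal.tsum_mul_right, h, tsum_walkLaw_singleton, one_mul]
    _ = _ := by simp

/-! ### Lattice sums -/

theorem sum_range_sq_div_sq_le {N : ℕ} (hN : 1 ≤ N) (M : ℕ) :
    ∑ n ∈ Finset.range M, ((1 + (n : ℝ) / N) ^ 2)⁻¹ ≤ 2 * (N : ℝ) := by
  have hN' : (1 : ℝ) ≤ N := by exact_mod_cast hN
  -- Telescoping: `1 / (N + M) ^ 2 ≤ 2 / (N + M) - 2 / (N + M + 1)`, since `N ≥ 1`.
  suffices h : ∑ n ∈ Finset.range M, ((1 + (n : ℝ) / N) ^ 2)⁻¹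
      ≤ 2 * N - 2 * (N : ℝ) ^ 2 / (N + M) from h.trans (by
        have : 0 ≤ 2 * (N : ℝ) ^ 2 / (N + M) := by positivity
        linarith)
  induction M with
  | zero =>
    simp only [Finset.range_zero, Finset.sum_empty, Nat.cast_zero, add_zero]
    rw [sq, ← mul_assoc, mul_div_cancel_right₀ _ (by positivity)]
    simp
  | succ M ih =>
    rw [Finset.sum_range_succ]
    have h1 : ((1 + (M : ℝ) / N) ^ 2)⁻¹
        ≤ 2 * (N : ℝ) ^ 2 / (N + M) - 2 * (N : ℝ) ^ 2 / (N + (M + 1 : ℕ)) := by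
      have hM : (0 : ℝ) ≤ M := Nat.cast_nonneg M
      have h2 : ((1 + (M : ℝ) / N) ^ 2)⁻¹ = (N : ℝ) ^ 2 / (N + M) ^ 2 := by
        field_simp
      rw [h2, div_sub_div _ _ (by positivity) (by positivity),
        div_le_div_iff₀ (by positivity) (by positivity)]
      push_cast
      have h3 : (N : ℝ) ^ 2 * ((N + M) * (N + (M + 1)))
          ≤ (N : ℝ) ^ 2 * (2 * (N + M) ^ 2) := by
        refine mul_le_mul_of_nonneg_left ?_ (by positivity)
        nlinarith
      calc (N : ℝ) ^ 2 * ((N + M) * (N + (M + 1))) ≤ (N : ℝ) ^ 2 * (2 * (N + M) ^ 2) := h3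
        _ = _ := by ring
    linarith

theorem tsum_int_le {N : ℕ} (hN : 1 ≤ N) :
    ∑' n : ℤ, ENNReal.ofReal ((1 + |(n : ℝ) / N|) ^ 2)⁻¹ ≤ ENNReal.ofReal (4 * N) := by
  have h1 : ∑' n : ℕ, ENNReal.ofReal ((1 + (n : ℝ) / N) ^ 2)⁻¹ ≤ ENNReal.ofReal (2 * N) := by
    refine ENNReal.tsum_le_of_sum_range_le fun M => ?_
    rw [← ENNReal.ofReal_sum_of_nonneg fun _ _ => by positivity]
    exact ENNReal.ofReal_le_ofReal (sum_range_sq_div_sq_le hN M)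
  have h2 : ∑' n : ℤ, ENNReal.ofReal ((1 + |(n : ℝ) / N|) ^ 2)⁻¹
      ≤ (∑' n : ℕ, ENNReal.ofReal ((1 + (n : ℝ) / N) ^ 2)⁻¹) +
        ∑' n : ℕ, ENNReal.ofReal ((1 + (n : ℝ) / N) ^ 2)⁻¹ := by
    rw [tsum_of_nat_of_neg_add_one ENNReal.summable ENNReal.summable]
    gcongr with n n
    · simp [abs_of_nonneg (show (0 : ℝ) ≤ (n : ℝ) / N by positivity)]
    · push_cast
      rw [neg_div, abs_neg, abs_of_nonneg (by positivity)]
      gcongr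
      linarith
  refine (h2.trans (add_le_add h1 h1)).trans (le_of_eq ?_)
  rw [← ENNReal.ofReal_add (by positivity) (by positivity)]
  congr 1
  ring

/-- The exponent `2 * d` leaves a square for each coordinate, so the sum is dominated by a product
of `d` one-dimensional sums of order `N`. -/
theorem tsum_lattice_le {N : ℕ} (hN : 1 ≤ N) :
    ∑' z : Site d, ENNReal.ofReal ((1 + ‖macro_point N z‖) ^ (2 * d))⁻¹
      ≤ ENNReal.ofReal ((4 * N) ^ d) := by
  calc ∑' z : Site d, ENNReal.ofReal ((1 + ‖macro_point N z‖) ^ (2 * d))⁻¹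
      ≤ ∑' z : Site d, ∏ i, ENNReal.ofReal ((1 + |((z i : ℤ) : ℝ) / N|) ^ 2)⁻¹ := by
        refine ENNReal.tsum_le_tsum fun z => ?_
        rw [← ENNReal.ofReal_prod_of_nonneg fun _ _ => by positivity]
        apply ENNReal.ofReal_le_ofReal
        rw [Finset.prod_inv_distrib]
        refine inv_anti₀ (Finset.prod_pos fun _ _ => by positivity) ?_
        calc ∏ i, (1 + |(z i : ℝ) / N|) ^ 2
            ≤ ∏ _i : Fin d, (1 + ‖macro_point N z‖) ^ 2 := by
              gcongr with i
              have := PiLp.norm_apply_le (macro_point N z) i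
              simpa only [macro_point, Real.norm_eq_abs] using this
          _ = _ := by
              rw [Finset.prod_const, Finset.card_univ, Fintype.card_fin, ← pow_mul]
    _ = ∏ _i : Fin d, ∑' n : ℤ, ENNReal.ofReal ((1 + |(n : ℝ) / N|) ^ 2)⁻¹ :=
        (prod_tsum fun (_ : Fin d) (n : ℤ) => ENNReal.ofReal ((1 + |(n : ℝ) / N|) ^ 2)⁻¹).symm
    _ ≤ ∏ _i : Fin d, ENNReal.ofReal (4 * N) := by
        gcongr
        exact tsum_int_le hN
    _ = _ := by
        rw [Finset.prod_const, Finset.card_univ, Fintype.card_fin, ENNReal.ofReal_pow (by positivity)]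

theorem exists_schwartz_bound (f : 𝓢(EuclideanSpace ℝ (Fin d), ℝ)) (M : ℕ) :
    ∃ S : ℝ, 0 ≤ S ∧ ∀ u, |f u| * (1 + ‖u‖) ^ M ≤ S := by
  obtain ⟨S, hS⟩ : ∃ S : ℝ, ∀ u, |f u| * (1 + ‖u‖) ^ M ≤ S := by
    refine ⟨2 ^ M * ((Finset.Iic (M, 0)).sup fun q => SchwartzMap.seminorm ℝ q.1 q.2) f, fun u => ?_⟩
    have h := SchwartzMap.one_add_le_sup_seminorm_apply (𝕜 := ℝ) (m := (M, 0)) (k := M) (n := 0)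
      le_rfl le_rfl f u
    rw [norm_iteratedFDeriv_zero, mul_comm, Real.norm_eq_abs] at h
    exact h
  exact ⟨S, le_trans (by positivity) (hS 0), hS⟩

end BoltzmannGibbs

end

noncomputable section

namespace BoltzmannGibbs

/-! ### Absolutely convergent series of square integrable functions -/

section Series

variable {Ω ι : Type*} {mΩ : MeasurableSpace Ω} {P : Measure Ω} [Countable ι]

theorem lintegral_enorm_mul_enorm_le {f g : Ω → ℝ} (hf : Measurable f) (hg : Measurable g)
    {c c' : ℝ≥0∞} (hc : ∫⁻ ω, ‖f ω‖ₑ ^ 2 ∂P ≤ c ^ 2) (hc' : ∫⁻ ω, ‖g ω‖ₑ ^ 2 ∂P ≤ c' ^ 2) :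
    ∫⁻ ω, ‖f ω‖ₑ * ‖g ω‖ₑ ∂P ≤ c * c' := by
  have h := ENNReal.lintegral_mul_le_Lp_mul_Lq P Real.HolderConjugate.two_two
    hf.enorm.aemeasurable hg.enorm.aemeasurable
  have h1 : ∀ {a b : ℝ≥0∞}, a ≤ b ^ 2 → a ^ (1 / (2 : ℝ)) ≤ b := by
    intro a b hab
    calc a ^ (1 / (2 : ℝ)) ≤ (b ^ 2) ^ (1 / (2 : ℝ)) := by gcongr
      _ = b := by
        rw [← ENNReal.rpow_natCast, ← ENNReal.rpow_mul]
        norm_num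
  refine h.trans (mul_le_mul' (h1 ?_) (h1 ?_))
  · simpa using hc
  · simpa using hc'

/-- Cauchy–Schwarz for each pair of terms. With summable `L²` bounds this yields absolute
convergence, square integrability of the sum and the interchange of sum and expectation. -/
theorem lintegral_tsum_enorm_mul_le {a b : ι → Ω → ℝ} (ha : ∀ z, Measurable (a z))
    (hb : ∀ z, Measurable (b z)) {c c' : ι → ℝ≥0∞}
    (hc : ∀ z, ∫⁻ ω, ‖a z ω‖ₑ ^ 2 ∂P ≤ c z ^ 2) (hc' : ∀ z, ∫⁻ ω, ‖b z ω‖ₑ ^ 2 ∂P ≤ c' z ^ 2) :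
    ∫⁻ ω, (∑' z, ‖a z ω‖ₑ) * (∑' w, ‖b w ω‖ₑ) ∂P ≤ (∑' z, c z) * ∑' w, c' w := by
  simp_rw [← ENNReal.tsum_mul_right, ← ENNReal.tsum_mul_left]
  have hm : ∀ z w, Measurable fun ω => ‖a z ω‖ₑ * ‖b w ω‖ₑ := fun z w =>
    (ha z).enorm.mul (hb w).enorm
  rw [lintegral_tsum fun z => (Measurable.tsum fun w => hm z w).aemeasurable]
  refine ENNReal.tsum_le_tsum fun z => ?_
  rw [lintegral_tsum fun w => (hm z w).aemeasurable]
  exact ENNReal.tsum_le_tsum fun w => lintegral_enorm_mul_enorm_le (ha z) (hb w) (hc z) (hc' w)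

theorem ae_summable_and_memLp_tsum {a : ι → Ω → ℝ} (ha : ∀ z, Measurable (a z)) {c : ι → ℝ≥0∞}
    (hc : ∀ z, ∫⁻ ω, ‖a z ω‖ₑ ^ 2 ∂P ≤ c z ^ 2) (hsum : ∑' z, c z ≠ ⊤) :
    (∀ᵐ ω ∂P, Summable fun z => a z ω) ∧ MemLp (fun ω => ∑' z, a z ω) 2 P := by
  have h1 := lintegral_tsum_enorm_mul_le ha ha hc hc
  have hfin := (h1.trans_lt (ENNReal.mul_lt_top hsum.lt_top hsum.lt_top))
  have hm : Measurable fun ω => ∑' z, ‖a z ω‖ₑ := Measurable.tsum fun z => (ha z).enorm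
  have h2 : ∀ᵐ ω ∂P, Summable fun z => a z ω := by
    filter_upwards [ae_lt_top (hm.mul hm) hfin.ne] with ω hω
    refine Summable.of_enorm fun htop => ?_
    simp [htop] at hω
  refine ⟨h2, (Measurable.tsum ha).aestronglyMeasurable, ?_⟩
  rw [eLpNorm_lt_top_iff_lintegral_rpow_enorm_lt_top (by norm_num) (by norm_num)]
  refine lt_of_le_of_lt (lintegral_mono_ae ?_) hfin
  filter_upwards [h2] with ω hω
  simp only [ENNReal.toReal_ofNat, ENNReal.rpow_ofNat, sq]
  have : ‖∑' z, a z ω‖ₑ ≤ ∑' z, ‖a z ω‖ₑ := enorm_tsum_le_tsum_enorm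
  gcongr

theorem integral_tsum_mul_tsum {a b : ι → Ω → ℝ} (ha : ∀ z, Measurable (a z))
    (hb : ∀ z, Measurable (b z)) {c c' : ι → ℝ≥0∞}
    (hc : ∀ z, ∫⁻ ω, ‖a z ω‖ₑ ^ 2 ∂P ≤ c z ^ 2) (hc' : ∀ z, ∫⁻ ω, ‖b z ω‖ₑ ^ 2 ∂P ≤ c' z ^ 2)
    (hsum : ∑' z, c z ≠ ⊤) (hsum' : ∑' z, c' z ≠ ⊤) :
    ∫ ω, (∑' z, a z ω) * (∑' w, b w ω) ∂P = ∑' q : ι × ι, ∫ ω, a q.1 ω * b q.2 ω ∂P := by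
  have h1 := lintegral_tsum_enorm_mul_le ha hb hc hc'
  have hfin := (h1.trans_lt (ENNReal.mul_lt_top hsum.lt_top hsum'.lt_top))
  have hm : ∀ q : ι × ι, Measurable fun ω => a q.1 ω * b q.2 ω := fun q =>
    (ha q.1).mul (hb q.2)
  rw [← integral_tsum fun q => (hm q).aestronglyMeasurable]
  · have hae : ∀ {f : ι → Ω → ℝ} {e : ι → ℝ≥0∞}, (∀ z, Measurable (f z)) →
        (∀ z, ∫⁻ ω, ‖f z ω‖ₑ ^ 2 ∂P ≤ e z ^ 2) → ∑' z, e z ≠ ⊤ →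
        ∀ᵐ ω ∂P, Summable fun z => ‖f z ω‖ := fun hf he hs => by
      filter_upwards [(ae_summable_and_memLp_tsum hf he hs).1] with ω hω using hω.norm
    refine integral_congr_ae ?_
    filter_upwards [hae ha hc hsum, hae hb hc' hsum'] with ω h2 h3
    exact tsum_mul_tsum_of_summable_norm h2 h3
  · rw [← lintegral_tsum fun q => (hm q).enorm.aemeasurable]
    refine ne_of_lt (lt_of_le_of_lt (lintegral_mono fun ω => ?_) hfin)
    rw [ENNReal.tsum_prod' , ← ENNReal.tsum_mul_right]
    refine ENNReal.tsum_le_tsum fun z => ?_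
    rw [← ENNReal.tsum_mul_left]
    refine ENNReal.tsum_le_tsum fun w => ?_
    rw [enorm_mul]

end Series

end BoltzmannGibbs

end

noncomputable section

namespace BoltzmannGibbs

variable {d : ℕ} {p : Site d → PMF (Site d)}

/-! ### The fluctuation field -/

/-- A summable weight on the lattice. -/
def latticeWeight (N : ℕ) (z : Site d) : ℝ := ((1 + ‖macro_point N z‖) ^ (2 * d))⁻¹

theorem latticeWeight_nonneg (N : ℕ) (z : Site d) : 0 ≤ latticeWeight N z := by
  unfold latticeWeight; positivity

theorem norm_macro_point_le_of_one_le {N : ℕ} (hN : 1 ≤ N) (v : Site d) :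
    ‖macro_point N v‖ ≤ ∑ i, |(v i : ℝ)| := by
  refine (norm_macro_point_le N v).trans (Finset.sum_le_sum fun i _ => ?_)
  rw [abs_div, Nat.abs_cast]
  exact div_le_self (abs_nonneg _) (by exact_mod_cast hN)

variable {ρ : EuclideanSpace ℝ (Fin d) → ℝ≥0} {A : ℝ} {m k : ℕ}

theorem IsAdmissible.exists_orthoNorm_bound (hp : IsAdmissible p) (hd : 1 ≤ d)
    (hρ : ∀ u, (ρ u : ℝ) ≤ A * (1 + ‖u‖) ^ m) (x : Fin k → Site d) (T : ℝ) (hT : 0 ≤ T) :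
    ∃ D : ℝ, 0 ≤ D ∧ ∀ (N : ℕ) (t : ℝ≥0) (z : Site d), 1 ≤ N → (t : ℝ) ≤ (N : ℝ) ^ 2 * T →
      orthoNorm (meanDensity p ρ N t) (toConfig fun i => z + x i)
        ≤ D * (1 + ‖macro_point N z‖) ^ (m * k) := by
  obtain ⟨B, hB0, hB⟩ := hp.exists_densityE_bound hd hρ T hT
  refine ⟨(k.factorial : ℕ) * ∏ i, (B * (1 + ∑ j, |(x i j : ℝ)|) ^ m), ?_, fun N t z hN ht => ?_⟩
  · exact mul_nonneg (Nat.cast_nonneg _) (Finset.prod_nonneg fun i _ => by positivity)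
  refine (orthoNorm_toConfig_le _ _).trans ?_
  rw [mul_assoc]
  gcongr
  have h1 : ∀ i, (meanDensity p ρ N t (z + x i) : ℝ)
      ≤ B * (1 + ∑ j, |(x i j : ℝ)|) ^ m * (1 + ‖macro_point N z‖) ^ m := by
    intro i
    rw [meanDensity, ENNReal.coe_toNNReal_eq_toReal]
    refine ENNReal.toReal_le_of_le_ofReal (by positivity) ((hB N t _ hN ht).trans ?_)
    apply ENNReal.ofReal_le_ofReal
    rw [mul_assoc, ← mul_pow, macro_point_add, mul_comm (1 + _)]
    gcongr
    refine (one_add_norm_add_le _ _).trans ?_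
    gcongr
    exact norm_macro_point_le_of_one_le hN _
  calc ∏ i, (meanDensity p ρ N t (z + x i) : ℝ)
      ≤ ∏ i, (B * (1 + ∑ j, |(x i j : ℝ)|) ^ m * (1 + ‖macro_point N z‖) ^ m) := by
        gcongr with i
        exact h1 i
    _ = _ := by
        rw [Finset.prod_mul_distrib, Finset.prod_const, Finset.card_univ, Fintype.card_fin,
          ← pow_mul]

theorem IsAdmissible.exists_field_bound (hp : IsAdmissible p) (hd : 1 ≤ d)
    (hρ : ∀ u, (ρ u : ℝ) ≤ A * (1 + ‖u‖) ^ m) (φ : 𝓢(EuclideanSpace ℝ (Fin d), ℝ))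
    (x : Fin k → Site d) (T : ℝ) (hT : 0 ≤ T) :
    ∃ K : ℝ, 0 ≤ K ∧ ∀ (N : ℕ) (t : ℝ≥0) (z : Site d), 1 ≤ N → (t : ℝ) ≤ (N : ℝ) ^ 2 * T →
      |φ (macro_point N z)| * orthoNorm (meanDensity p ρ N t) (toConfig fun i => z + x i)
          ≤ K * latticeWeight N z ∧
        φ (macro_point N z) ^ 2 * orthoNorm (meanDensity p ρ N t) (toConfig fun i => z + x i)
          ≤ (K * latticeWeight N z) ^ 2 := by
  obtain ⟨D, hD0, hD⟩ := hp.exists_orthoNorm_bound hd hρ x T hT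
  obtain ⟨S, hS0, hS⟩ := exists_schwartz_bound φ (m * k + 2 * d)
  -- With `D + 1` in place of `D` one constant serves both bounds, since `D ≤ D + 1` and `D ≤ (D +
  -- 1) ^ 2`. The first bound is for covariances, the second for `L²` norms of single terms.
  refine ⟨(D + 1) * S, by positivity, fun N t z hN ht => ?_⟩
  set u := macro_point N z
  set W := latticeWeight N z with hW
  have hW0 : 0 ≤ W := latticeWeight_nonneg N z
  have hWpos : (1 + ‖u‖) ^ (2 * d) * W = 1 := mul_inv_cancel₀ (by positivity)
  have h1 : |φ u| * (1 + ‖u‖) ^ (m * k) ≤ S * W := by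
    calc |φ u| * (1 + ‖u‖) ^ (m * k)
        = |φ u| * (1 + ‖u‖) ^ (m * k) * ((1 + ‖u‖) ^ (2 * d) * W) := by rw [hWpos, mul_one]
      _ = |φ u| * (1 + ‖u‖) ^ (m * k + 2 * d) * W := by rw [pow_add]; ring
      _ ≤ S * W := by gcongr; exact hS u
  have h2 : |φ u| ≤ S * W :=
    (le_mul_of_one_le_right (abs_nonneg _)
      (one_le_pow₀ (by linarith [norm_nonneg u]))).trans h1
  have h3 : |φ u| * orthoNorm (meanDensity p ρ N t) (toConfig fun i => z + x i) ≤ D * (S * W) := by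
    calc |φ u| * orthoNorm (meanDensity p ρ N t) (toConfig fun i => z + x i)
        ≤ |φ u| * (D * (1 + ‖u‖) ^ (m * k)) := by gcongr; exact hD N t z hN ht
      _ = D * (|φ u| * (1 + ‖u‖) ^ (m * k)) := by ring
      _ ≤ D * (S * W) := by gcongr
  have hSW : 0 ≤ S * W := by positivity
  refine ⟨by nlinarith, ?_⟩
  rw [← sq_abs, sq, mul_assoc]
  calc |φ u| * (|φ u| * orthoNorm (meanDensity p ρ N t) (toConfig fun i => z + x i))
      ≤ (S * W) * (D * (S * W)) :=
        mul_le_mul h2 h3 (mul_nonneg (abs_nonneg _) (orthoNorm_nonneg _ _)) hSW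
    _ ≤ _ := by nlinarith [mul_nonneg hD0 hD0, mul_nonneg hSW hSW, mul_nonneg hD0 (mul_nonneg hSW hSW),
        mul_nonneg (mul_nonneg hD0 hD0) (mul_nonneg hSW hSW)]

theorem tsum_latticeWeight_le {N : ℕ} (hN : 1 ≤ N) {K : ℝ} (hK : 0 ≤ K) :
    ∑' z : Site d, ENNReal.ofReal (K * latticeWeight N z) ≤ ENNReal.ofReal (K * (4 * N) ^ d) := by
  simp_rw [ENNReal.ofReal_mul hK]
  rw [ENNReal.tsum_mul_left]
  gcongr
  exact tsum_lattice_le hN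

theorem measurable_fieldTerm (φ : 𝓢(EuclideanSpace ℝ (Fin d), ℝ))
    (x : Fin k → Site d) (N : ℕ) (t : ℝ≥0) (z : Site d) :
    Measurable fun ζ : Config d => fieldTerm p ρ φ x N t ζ z :=
  (measurable_orthoPoly _ _).const_mul _

section Walkers

variable {Ω : Type*} {mΩ : MeasurableSpace Ω} {P : Measure Ω} [IsProbabilityMeasure P]
  {N : ℕ} {η : ℝ≥0 → Ω → Config d}

theorem le_sq_mul_of_le {N : ℕ} {t : ℝ≥0} {T : ℝ} (ht : (t : ℝ) ≤ T) :
    (((N : ℝ≥0) ^ 2 * t : ℝ≥0) : ℝ) ≤ (N : ℝ) ^ 2 * T := by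
  push_cast
  gcongr

theorem IsIRW.exists_lintegral_fieldTerm_sq_le (h : IsIRW p (localEquilibrium ρ N) P η)
    (hp : IsAdmissible p) (hd : 1 ≤ d) (hρ : ∀ u, (ρ u : ℝ) ≤ A * (1 + ‖u‖) ^ m) (hN : 1 ≤ N)
    (φ : 𝓢(EuclideanSpace ℝ (Fin d), ℝ)) (x : Fin k → Site d) (t : ℝ≥0) :
    ∃ c : Site d → ℝ≥0∞, ∑' z, c z ≠ ⊤ ∧
      ∀ z, ∫⁻ ω, ‖fieldTerm p ρ φ x N t (η ((N : ℝ≥0) ^ 2 * t) ω) z‖ₑ ^ 2 ∂P ≤ c z ^ 2 := by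
  obtain ⟨K, hK0, hK⟩ := hp.exists_field_bound hd hρ φ x t t.coe_nonneg
  refine ⟨fun z => ENNReal.ofReal (K * latticeWeight N z),
    ((tsum_latticeWeight_le hN hK0).trans_lt ENNReal.ofReal_lt_top).ne, fun z => ?_⟩
  set ξ := toConfig fun i => z + x i with hξ
  have h1 : ∀ ω, ‖fieldTerm p ρ φ x N t (η ((N : ℝ≥0) ^ 2 * t) ω) z‖ₑ ^ 2
      = ENNReal.ofReal (φ (macro_point N z) ^ 2 *
        orthoPoly (density p ρ N ((N : ℝ≥0) ^ 2 * t)) ξ (η ((N : ℝ≥0) ^ 2 * t) ω) ^ 2) := by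
    intro ω
    rw [Real.enorm_eq_ofReal_abs, ← ENNReal.ofReal_pow (abs_nonneg _), sq_abs, fieldTerm, mul_pow]
  simp_rw [h1]
  have hint := (h.memLp_orthoPoly hp hd hρ hN ((N : ℝ≥0) ^ 2 * t) ξ).integrable_sq
  rw [← ofReal_integral_eq_lintegral_ofReal (hint.const_mul _)
    (ae_of_all _ fun ω => by positivity), integral_const_mul,
    h.integral_orthoPoly_sq hp hd hρ hN,
    ← ENNReal.ofReal_pow (mul_nonneg hK0 (latticeWeight_nonneg N z))]
  exact ENNReal.ofReal_le_ofReal (hK N _ z hN (le_sq_mul_of_le le_rfl)).2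

theorem IsIRW.ae_summable_and_memLp_field (h : IsIRW p (localEquilibrium ρ N) P η)
    (hp : IsAdmissible p) (hd : 1 ≤ d) (hρ : ∀ u, (ρ u : ℝ) ≤ A * (1 + ‖u‖) ^ m) (hN : 1 ≤ N)
    (φ : 𝓢(EuclideanSpace ℝ (Fin d), ℝ)) (x : Fin k → Site d) (t : ℝ≥0) :
    (∀ᵐ ω ∂P, Summable (fieldTerm p ρ φ x N t (η ((N : ℝ≥0) ^ 2 * t) ω))) ∧
      MemLp (field p ρ φ x N η t) 2 P := by
  obtain ⟨c, hc, hc'⟩ := h.exists_lintegral_fieldTerm_sq_le hp hd hρ hN φ x t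
  exact ae_summable_and_memLp_tsum
    (fun z => (measurable_fieldTerm φ x N t z).comp (h.measurable _)) hc' hc

/-- The covariance of two summands of the field, at the times `s + u` and `s`. -/
def covTerm (p : Site d → PMF (Site d)) (ρ : EuclideanSpace ℝ (Fin d) → ℝ≥0)
    (φ : 𝓢(EuclideanSpace ℝ (Fin d), ℝ)) (x : Fin k → Site d) (N : ℕ) (s u : ℝ≥0)
    (z w : Site d) : ℝ :=
  φ (macro_point N z) * (φ (macro_point N w) *
    orthoNorm (meanDensity p ρ N ((N : ℝ≥0) ^ 2 * s)) (toConfig fun i => w + x i)) *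
    (tupleTransition p ((N : ℝ≥0) ^ 2 * u) (toConfig fun i => w + x i) fun i => z + x i).toReal

theorem measurable_covTerm (φ : 𝓢(EuclideanSpace ℝ (Fin d), ℝ)) (x : Fin k → Site d) (N : ℕ)
    (z w : Site d) : Measurable fun q : ℝ≥0 × ℝ≥0 => covTerm p ρ φ x N q.1 q.2 z w := by
  have h1 : Measurable fun s : ℝ≥0 =>
      orthoNorm (meanDensity p ρ N ((N : ℝ≥0) ^ 2 * s)) (toConfig fun i => w + x i) := by
    unfold orthoNorm Finsupp.prod
    refine Finset.measurable_fun_prod _ fun y _ => Measurable.const_mul (Measurable.pow_const ?_ _) _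
    exact ((measurable_densityE ρ N y).comp (measurable_const_mul _)).ennreal_toNNReal.coe_nnreal_real
  have h2 : Measurable fun u : ℝ≥0 => (tupleTransition p ((N : ℝ≥0) ^ 2 * u)
      (toConfig fun i => w + x i) fun i => z + x i).toReal :=
    ((measurable_tupleTransition _ _).comp (measurable_const_mul _)).ennreal_toReal
  exact (((h1.comp measurable_fst).const_mul _).const_mul _).mul (h2.comp measurable_snd)

theorem IsIRW.integral_field_mul_field_of_le (h : IsIRW p (localEquilibrium ρ N) P η)
    (hp : IsAdmissible p) (hd : 1 ≤ d) (hρ : ∀ u, (ρ u : ℝ) ≤ A * (1 + ‖u‖) ^ m) (hN : 1 ≤ N)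
    (φ : 𝓢(EuclideanSpace ℝ (Fin d), ℝ)) (x : Fin k → Site d) {s t : ℝ≥0} (hst : s ≤ t) :
    ∫ ω, field p ρ φ x N η t ω * field p ρ φ x N η s ω ∂P
      = ∑' q : Site d × Site d, covTerm p ρ φ x N s (t - s) q.1 q.2 := by
  obtain ⟨c, hc, hc'⟩ := h.exists_lintegral_fieldTerm_sq_le hp hd hρ hN φ x t
  obtain ⟨e, he, he'⟩ := h.exists_lintegral_fieldTerm_sq_le hp hd hρ hN φ x s
  have h1 := integral_tsum_mul_tsum
    (fun z => (measurable_fieldTerm φ x N t z).comp (h.measurable _))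
    (fun z => (measurable_fieldTerm φ x N s z).comp (h.measurable _)) hc' he' hc he
  refine h1.trans (tsum_congr fun q => ?_)
  have h2 := h.integral_orthoPoly_mul_orthoPoly hp hd hρ hN
    (mul_le_mul_right hst ((N : ℝ≥0) ^ 2)) (fun i => q.2 + x i) (fun i => q.1 + x i)
  rw [covTerm, mul_tsub, mul_assoc, mul_assoc, ← h2, ← integral_const_mul, ← integral_const_mul]
  refine integral_congr_ae (ae_of_all _ fun ω => ?_)
  simp only [Function.comp_apply, fieldTerm]
  ring

/-- The symmetric form in `min` and `max` covers both time orders by one expression, visibly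
measurable in the pair of times. -/
theorem IsIRW.integral_field_mul_field (h : IsIRW p (localEquilibrium ρ N) P η)
    (hp : IsAdmissible p) (hd : 1 ≤ d) (hρ : ∀ u, (ρ u : ℝ) ≤ A * (1 + ‖u‖) ^ m) (hN : 1 ≤ N)
    (φ : 𝓢(EuclideanSpace ℝ (Fin d), ℝ)) (x : Fin k → Site d) (t s : ℝ≥0) :
    ∫ ω, field p ρ φ x N η t ω * field p ρ φ x N η s ω ∂P
      = ∑' q : Site d × Site d, covTerm p ρ φ x N (min t s) (max t s - min t s) q.1 q.2 := by
  rcases le_total s t with hst | hst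
  · rw [min_eq_right hst, max_eq_left hst]
    exact h.integral_field_mul_field_of_le hp hd hρ hN φ x hst
  · rw [min_eq_left hst, max_eq_right hst, ← h.integral_field_mul_field_of_le hp hd hρ hN φ x hst]
    simp_rw [mul_comm]

end Walkers

/-- Bound `φ` at the later site `z` by its supremum and sum over `z` first, which gives `κ ^ l`; the
earlier factor carries the lattice weight in `w`, whose sum gives `N ^ d`. -/
theorem IsAdmissible.exists_tsum_covTerm_bound (hp : IsAdmissible p) (hd : 1 ≤ d)
    (hρ : ∀ u, (ρ u : ℝ) ≤ A * (1 + ‖u‖) ^ m) (φ : 𝓢(EuclideanSpace ℝ (Fin d), ℝ))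
    {l : ℕ} (x : Fin (l + 1) → Site d) (T : ℝ) (hT : 0 ≤ T) :
    ∃ K : ℝ, 0 ≤ K ∧ ∀ (N : ℕ) (s u : ℝ≥0) (κ : ℝ), 1 ≤ N → (s : ℝ) ≤ T → 0 ≤ κ →
      (∀ w z, walkLaw p ((N : ℝ≥0) ^ 2 * u) w {z} ≤ ENNReal.ofReal κ) →
      |∑' q : Site d × Site d, covTerm p ρ φ x N s u q.1 q.2| ≤ K * (N : ℝ) ^ d * κ ^ l := by
  obtain ⟨K, hK0, hK⟩ := hp.exists_field_bound hd hρ φ x T hT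
  obtain ⟨S, hS0, hS⟩ := exists_schwartz_bound φ 0
  refine ⟨K * 4 ^ d * S * ((l + 1) ^ (l + 1) : ℕ), by positivity, ?_⟩
  intro N s u κ hN hs hκ0 hκ
  rw [← ENNReal.ofReal_le_ofReal_iff (by positivity), ← Real.enorm_eq_ofReal_abs]
  refine enorm_tsum_le_tsum_enorm.trans ?_
  rw [ENNReal.tsum_prod (f := fun z w => ‖covTerm p ρ φ x N s u z w‖ₑ), ENNReal.tsum_comm]
  have h1 : ∀ z w, ‖covTerm p ρ φ x N s u z w‖ₑ ≤
      ENNReal.ofReal (K * latticeWeight N w) * ENNReal.ofReal S *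
        tupleTransition p ((N : ℝ≥0) ^ 2 * u) (toConfig fun i => w + x i) fun i => z + x i := by
    intro z w
    rw [covTerm, enorm_mul, enorm_mul, mul_comm ‖φ _‖ₑ]
    gcongr
    · rw [Real.enorm_eq_ofReal_abs]
      apply ENNReal.ofReal_le_ofReal
      rw [abs_mul, abs_of_nonneg (orthoNorm_nonneg _ _)]
      exact (hK N _ w hN (le_sq_mul_of_le hs)).1
    · rw [Real.enorm_eq_ofReal_abs]
      apply ENNReal.ofReal_le_ofReal
      simpa using hS (macro_point N z)
    · rw [Real.enorm_eq_ofReal_abs, abs_of_nonneg ENNReal.toReal_nonneg]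
      exact ENNReal.ofReal_toReal_le
  calc ∑' w, ∑' z, ‖covTerm p ρ φ x N s u z w‖ₑ
      ≤ ∑' w : Site d, ENNReal.ofReal (K * latticeWeight N w) * ENNReal.ofReal S *
          (((l + 1) ^ (l + 1) : ℕ) * ENNReal.ofReal κ ^ l) := by
        refine ENNReal.tsum_le_tsum fun w => (ENNReal.tsum_le_tsum fun z => h1 z w).trans ?_
        rw [ENNReal.tsum_mul_left]
        gcongr
        exact tsum_tupleTransition_le _ _ _ hκ
    _ ≤ ENNReal.ofReal (K * (4 * N) ^ d) * ENNReal.ofReal S *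
          (((l + 1) ^ (l + 1) : ℕ) * ENNReal.ofReal κ ^ l) := by
        rw [ENNReal.tsum_mul_right, ENNReal.tsum_mul_right]
        gcongr
        exact tsum_latticeWeight_le hN hK0
    _ = _ := by
        rw [← ENNReal.ofReal_natCast, ← ENNReal.ofReal_pow hκ0, ← ENNReal.ofReal_mul (by positivity),
          ← ENNReal.ofReal_mul (by positivity), ← ENNReal.ofReal_mul (by positivity)]
        congr 1
        rw [mul_pow]
        ring

/-! ### The time integral -/

theorem integral_integral_le_of_off_diagonal {f : ℝ → ℝ → ℝ} {T ε M c : ℝ} (hT : 0 ≤ T)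
    (hε : 0 < ε) (hM : 0 ≤ M) (hc : 0 ≤ c)
    (h1 : ∀ t ∈ Set.Ioc 0 T, ∀ s ∈ Set.Ioc 0 T, |f t s| ≤ M)
    (h2 : ∀ t ∈ Set.Ioc 0 T, ∀ s ∈ Set.Ioc 0 T, ε ≤ |t - s| → |f t s| ≤ M * (c * ε)) :
    ∫ t in (0 : ℝ)..T, ∫ s in (0 : ℝ)..T, f t s ≤ M * (2 + T * c) * T * ε := by
  have hin : ∀ t ∈ Set.Ioc 0 T, ‖∫ s in (0 : ℝ)..T, f t s‖ ≤ M * (2 + T * c) * ε := by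
    intro t ht
    -- For fixed `t` the near-diagonal set has length at most `2 * ε`, and off it the bound is
    -- already of order `ε`.
    set g : ℝ → ℝ := fun s => M * ((Set.Ioo (t - ε) (t + ε)).indicator (fun _ => 1) s + c * ε)
    have hind : Integrable ((Set.Ioo (t - ε) (t + ε)).indicator fun _ => (1 : ℝ)) :=
      (integrable_indicator_iff measurableSet_Ioo).mpr (integrableOn_const (by simp))
    have hg : IntervalIntegrable g volume 0 T :=
      (hind.intervalIntegrable.add intervalIntegrable_const).const_mul M
    refine (intervalIntegral.norm_integral_le_of_norm_le (g := g) hT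
      (ae_of_all _ fun s hs => ?_) hg).trans ?_
    · rw [Real.norm_eq_abs]
      by_cases hts : ε ≤ |t - s|
      · refine (h2 t ht s hs hts).trans ?_
        have : 0 ≤ (Set.Ioo (t - ε) (t + ε)).indicator (fun _ => (1 : ℝ)) s :=
          Set.indicator_nonneg (fun _ _ => zero_le_one) s
        exact mul_le_mul_of_nonneg_left (by linarith) hM
      · push Not at hts
        rw [abs_lt] at hts
        have hs' : s ∈ Set.Ioo (t - ε) (t + ε) := ⟨by linarith, by linarith⟩
        refine (h1 t ht s hs).trans ?_
        simp only [g, Set.indicator_of_mem hs']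
        have : 0 ≤ c * ε := by positivity
        nlinarith
    · rw [intervalIntegral.integral_const_mul, intervalIntegral.integral_add
        hind.intervalIntegrable intervalIntegrable_const, intervalIntegral.integral_const,
        mul_assoc]
      have h3 : ∫ s in (0 : ℝ)..T, (Set.Ioo (t - ε) (t + ε)).indicator (fun _ => (1 : ℝ)) s
          ≤ 2 * ε := by
        rw [intervalIntegral.integral_of_le hT]
        refine (setIntegral_le_integral hind (ae_of_all _ fun s =>
          Set.indicator_nonneg (fun _ _ => zero_le_one) s)).trans (le_of_eq ?_)
        rw [integral_indicator measurableSet_Ioo, setIntegral_const, smul_eq_mul, mul_one,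
          measureReal_def, Real.volume_Ioo, ENNReal.toReal_ofReal (by linarith)]
        ring
      refine mul_le_mul_of_nonneg_left ?_ hM
      simp only [smul_eq_mul, sub_zero]
      linarith
  have hout := intervalIntegral.norm_integral_le_of_norm_le_const (a := 0) (b := T)
    (f := fun t => ∫ s in (0 : ℝ)..T, f t s) (C := M * (2 + T * c) * ε) (by
      rw [Set.uIoc_of_le hT]
      exact hin)
  rw [sub_zero, abs_of_nonneg hT] at hout
  refine (Real.le_norm_self _).trans (hout.trans (le_of_eq (by ring)))

/-- With this choice of the time scale `ε`, the off-diagonal bound is of order `ε`. -/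
theorem inv_pow_le_rpow {N : ℕ} (hN : 1 ≤ N) (n : ℕ) {u : ℝ}
    (hu : (N : ℝ) ^ (-(2 * (n : ℝ)) / (2 + n)) ≤ u) :
    ((Real.sqrt ((N : ℝ) ^ 2 * u))⁻¹) ^ n ≤ (N : ℝ) ^ (-(2 * (n : ℝ)) / (2 + n)) := by
  have hN0 : (0 : ℝ) < N := by exact_mod_cast hN
  have h1 : (N : ℝ) ^ (2 / (2 + (n : ℝ))) ≤ Real.sqrt ((N : ℝ) ^ 2 * u) := by
    apply Real.le_sqrt_of_sq_le
    calc ((N : ℝ) ^ (2 / (2 + (n : ℝ)))) ^ 2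
        = (N : ℝ) ^ 2 * (N : ℝ) ^ (-(2 * (n : ℝ)) / (2 + n)) := by
          rw [← Real.rpow_natCast, ← Real.rpow_mul hN0.le, ← Real.rpow_natCast, ← Real.rpow_add hN0]
          congr 1
          push_cast
          field_simp
          ring
      _ ≤ _ := by gcongr
  calc ((Real.sqrt ((N : ℝ) ^ 2 * u))⁻¹) ^ n ≤ (((N : ℝ) ^ (2 / (2 + (n : ℝ))))⁻¹) ^ n := by
        gcongr
    _ = _ := by
        rw [← Real.rpow_neg hN0.le, ← Real.rpow_natCast, ← Real.rpow_mul hN0.le]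
        congr 1
        ring

end BoltzmannGibbs

end

noncomputable section

namespace BoltzmannGibbs

theorem measurable_tsum_covTerm_min_max {d k : ℕ} {p : Site d → PMF (Site d)}
    {ρ : EuclideanSpace ℝ (Fin d) → ℝ≥0} (φ : 𝓢(EuclideanSpace ℝ (Fin d), ℝ))
    (x : Fin k → Site d) (N : ℕ) :
    Measurable fun r : ℝ × ℝ => ∑' q : Site d × Site d,
      covTerm p ρ φ x N (min r.1.toNNReal r.2.toNNReal)
        (max r.1.toNNReal r.2.toNNReal - min r.1.toNNReal r.2.toNNReal) q.1 q.2 := by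
  have h1 : Measurable fun q : ℝ × ℝ => (min q.1.toNNReal q.2.toNNReal,
      max q.1.toNNReal q.2.toNNReal - min q.1.toNNReal q.2.toNNReal) := by fun_prop
  refine Measurable.tsum fun q => ?_
  have h2 := (measurable_covTerm (p := p) (ρ := ρ) φ x N q.1 q.2).comp h1
  simpa only [Function.comp_def] using h2

end BoltzmannGibbs

end

/-! ### Assembly: diagonal strip against off-diagonal decay -/

theorem mainTheorem7 {d : ℕ} (hd : 1 ≤ d)
    (p : BoltzmannGibbs.Site d → PMF (BoltzmannGibbs.Site d))
    (hp : BoltzmannGibbs.IsAdmissible p)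
    (ρ : EuclideanSpace ℝ (Fin d) → ℝ≥0)
    (hρ : ∃ (A : ℝ) (m : ℕ), ∀ u, (ρ u : ℝ) ≤ A * (1 + ‖u‖) ^ m)
    (φ : 𝓢(EuclideanSpace ℝ (Fin d), ℝ))
    {k : ℕ} (hk : 1 ≤ k) (x : Fin k → BoltzmannGibbs.Site d)
    (T : ℝ) (hT : 0 < T) :
    ∃ C : ℝ, ∀ᶠ N : ℕ in atTop,
      ∀ (Ω : Type*) [MeasurableSpace Ω] (P : Measure Ω) [IsProbabilityMeasure P]
        (η : ℝ≥0 → Ω → BoltzmannGibbs.Config d),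
        BoltzmannGibbs.IsIRW p (BoltzmannGibbs.localEquilibrium ρ N) P η →
        (∀ t : ℝ≥0,
          (∀ᵐ ω ∂P, Summable
            (BoltzmannGibbs.fieldTerm p ρ φ x N t (η ((N : ℝ≥0) ^ 2 * t) ω))) ∧
          MemLp (BoltzmannGibbs.field p ρ φ x N η t) 2 P) ∧
        IntegrableOn
          (fun q : ℝ × ℝ => ∫ ω, BoltzmannGibbs.field p ρ φ x N η q.1.toNNReal ω *
            BoltzmannGibbs.field p ρ φ x N η q.2.toNNReal ω ∂P)
          (Set.Icc 0 T ×ˢ Set.Icc 0 T) ∧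
        1 / (N : ℝ) ^ d *
            ∫ t in (0 : ℝ)..T, ∫ s in (0 : ℝ)..T,
              ∫ ω, BoltzmannGibbs.field p ρ φ x N η t.toNNReal ω *
                BoltzmannGibbs.field p ρ φ x N η s.toNNReal ω ∂P
          ≤ C * (N : ℝ) ^ (-(2 * ((k : ℝ) - 1) * (d : ℝ)) / (2 + ((k : ℝ) - 1) * (d : ℝ))) := by
  obtain ⟨A, m, hρ⟩ := hρ
  obtain ⟨l, rfl⟩ : ∃ l, k = l + 1 := ⟨k - 1, by omega⟩
  obtain ⟨K, hK0, hK⟩ := hp.exists_tsum_covTerm_bound hd hρ φ x T hT.le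
  obtain ⟨C, hC0, hC⟩ := hp.exists_heatKernel_bound
  -- The `2` comes from the strip around the diagonal and `T * C ^ l` from the heat kernel bound off
  -- it.
  refine ⟨K * (2 + T * C ^ l) * T, ?_⟩
  filter_upwards [eventually_ge_atTop 1] with N hN
  intro Ω _ P _ η h
  refine ⟨fun t => h.ae_summable_and_memLp_field hp hd hρ hN φ x t, ?_⟩
  have hN0 : (0 : ℝ) < N := by exact_mod_cast hN
  simp_rw [h.integral_field_mul_field hp hd hρ hN φ x]
  set F : ℝ → ℝ → ℝ := fun t s => ∑' q : BoltzmannGibbs.Site d × BoltzmannGibbs.Site d,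
    BoltzmannGibbs.covTerm p ρ φ x N (min t.toNNReal s.toNNReal)
      (max t.toNNReal s.toNNReal - min t.toNNReal s.toNNReal) q.1 q.2 with hF
  have hmin : ∀ {t s : ℝ}, t ≤ T → ((min t.toNNReal s.toNNReal : ℝ≥0) : ℝ) ≤ T := fun {t s} ht =>
    (NNReal.coe_le_coe.mpr (min_le_left _ _)).trans (by
      rw [Real.coe_toNNReal']
      exact max_le ht hT.le)
  -- The trivial heat kernel bound `κ = 1`, used near the diagonal and for integrability on the
  -- square.
  have hF1 : ∀ t s, t ≤ T → |F t s| ≤ K * (N : ℝ) ^ d := by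
    intro t s ht
    have h1 := hK N (min t.toNNReal s.toNNReal)
      (max t.toNNReal s.toNNReal - min t.toNNReal s.toNNReal) 1 hN (hmin ht) zero_le_one
      fun w z => by simpa using prob_le_one
    simpa using h1
  set n : ℕ := d * l with hn
  -- The scale at which `(N ^ 2 * ε) ^ (-n / 2) = ε`, balancing strip and complement; for `k = 1` it
  -- is `1`.
  set ε : ℝ := (N : ℝ) ^ (-(2 * (n : ℝ)) / (2 + n)) with hε
  have hε0 : 0 < ε := Real.rpow_pos_of_pos hN0 _
  have hF2 : ∀ t ∈ Set.Ioc 0 T, ∀ s ∈ Set.Ioc 0 T, ε ≤ |t - s| →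
      |F t s| ≤ K * (N : ℝ) ^ d * (C ^ l * ε) := by
    intro t ht s hs hts
    set u : ℝ≥0 := max t.toNNReal s.toNNReal - min t.toNNReal s.toNNReal with hu
    have hu' : (u : ℝ) = |t - s| := by
      rw [hu, NNReal.coe_sub (min_le_max), NNReal.coe_max, NNReal.coe_min,
        Real.coe_toNNReal _ ht.1.le, Real.coe_toNNReal _ hs.1.le, max_sub_min_eq_abs']
    have hupos : 0 < (N : ℝ≥0) ^ 2 * u := by
      have h1 : (0 : ℝ) < u := by
        rw [hu']
        exact hε0.trans_le hts
      have h2 : (0 : ℝ≥0) < N := by exact_mod_cast hN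
      exact mul_pos (pow_pos h2 2) (by exact_mod_cast h1)
    have h1 := hK N (min t.toNNReal s.toNNReal) u
      (C * (Real.sqrt ((N : ℝ) ^ 2 * u))⁻¹ ^ d) hN (hmin ht.2) (by positivity) fun w z => by
        have h2 := hC ((N : ℝ≥0) ^ 2 * u) w z hupos
        push_cast at h2
        exact h2
    refine h1.trans ?_
    rw [mul_pow, ← pow_mul]
    gcongr
    exact BoltzmannGibbs.inv_pow_le_rpow hN n (by rwa [hu'])
  constructor
  · have hmeas : Measurable fun q : ℝ × ℝ => F q.1 q.2 :=
      BoltzmannGibbs.measurable_tsum_covTerm_min_max φ x N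
    refine Measure.integrableOn_of_bounded (M := K * (N : ℝ) ^ d)
      (isCompact_Icc.prod isCompact_Icc).measure_lt_top.ne hmeas.aestronglyMeasurable ?_
    filter_upwards [ae_restrict_mem (measurableSet_Icc.prod measurableSet_Icc)] with q hq
    exact hF1 q.1 q.2 hq.1.2
  · have h1 := BoltzmannGibbs.integral_integral_le_of_off_diagonal (f := F) hT.le hε0
      (M := K * (N : ℝ) ^ d) (c := C ^ l) (by positivity) (by positivity)
      (fun t ht s _ => hF1 t s ht.2) hF2
    have h2 : -(2 * (((l + 1 : ℕ) : ℝ) - 1) * (d : ℝ)) / (2 + (((l + 1 : ℕ) : ℝ) - 1) * (d : ℝ))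
        = -(2 * (n : ℝ)) / (2 + n) := by
      rw [hn]
      push_cast
      congr 1 <;> ring
    rw [h2]
    calc 1 / (N : ℝ) ^ d * ∫ t in (0 : ℝ)..T, ∫ s in (0 : ℝ)..T, F t s
        ≤ 1 / (N : ℝ) ^ d * (K * (N : ℝ) ^ d * (2 + T * C ^ l) * T * ε) := by gcongr
      _ = K * (2 + T * C ^ l) * T * ε := by
        field_simp
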